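/- **Theorem (quantum Borůvka algorithm for minimum spanning trees).** *Inputs.* Let $G$ be a simple undirected graph with vertex set $\{0,\dots,n-1\}$, $n\ge 1$, with $m$ edges and edge weights $w(e)\in\{0,\dots,W\}$ ($W$ is any known bound). In the *array model* the degrees are known, and a query $(u,j)$ returns the $j$-th neighbour $v$ of $u$ together with $w(uv)$; the neighbours of $u$ are listed in arbitrary order, each once. In the *matrix model* a query $(u,v)$ returns $w(uv)$ if $uv$ is an edge and $\infty$ otherwise. In both cases the input is a black box $x:Q\to A$, and an index $q\in Q$ with its answer $x(q)$ describes a directed pair $(u,v)$ with a weight in $\mathbb N\cup\{\infty\}$; put $N=|Q|$ (so $N=2m$ in the array model, $N=n^2$ in the matrix model). A quantum query is the unitary $|q,a,z\rangle\mapsto|q,a+x(q),z\rangle$, where the finite set $A$ of answers is an abelian group. A quantum query algorithm consists of input-independent unitaries, queries, measurements, random choices and classical control. *Search.* To search for an index $q$ with a property $F(q,x(q))$, perform trials $s=0,1,2,\dots$: choose an integer $j$ with $0\le j<\min\{(6/5)^s,\sqrt N\}$ uniformly at random, apply $j$ Grover iterations (two queries each) to the uniform superposition over $Q$, measure an index $q$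 with its value (one query), and stop if $F(q,x(q))$ holds. *The $d$ smallest values of different type.* Given functions $f$ (value in $\mathbb N\cup\{\infty\}$) and $g$ (type) of an index and its answer, and an integer $d$, keep a selection of $d$ items of different types, initially artificial items with private types and value $\infty$. An index $j$ is good if $f(j)<f(i)$ for some selected $i$ of the same type, or if the type of $j$ is not in the selection and $f(j)<f(i)$ for some selected $i$. Repeatedly search for a good index $j$ and let it replace the selected item of its type or, if there is none, a selected item of largest value. Given a query budget, the routine is interrupted before the first search trial that would exceed the budget; its output is the set of selected items that are not artificial. *The algorithm.* Fix a real number $c>0$ and start with the empty forest (every vertex is a tree). For $\ell=1,2,\dots,\lceil\log_2 n\rceil$, unless the forest is a single tree, let $k$ be its number of trees. Let $f$ be the weight of a directed pair $(u,v)$ if $u$ and $v$ lie in different trees, and $\infty$ otherwise; let $g$ be the tree containing $u$. Run the routine above for $f,g$ with $d=k$, interrupted after $\big\lfloor(\ell+2)\,c\sqrt{\min\{k,\,n/2^{\ell-1}\}\,N}\big\rfloor$ queries. Then add the edges found one after the other, omitting an edge whose endpoints already lie in the same tree. Output the resulting edge set. *Claim.* There are absolute constants $c,C>0$ such that for all $n$,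 $W$, $G$, $w$ the algorithm with this $c$ has the following properties. 1. In the array model, for every array representation of $(G,w)$, it outputs a minimum spanning forest of $G$ with probability at least $3/4$, and every run makes at most $C\sqrt{nm}$ queries. 2. In the matrix model, it outputs a minimum spanning forest of $G$ with probability at least $3/4$, and every run makes at most $C\,n^{3/2}$ queries. Here a minimum spanning forest is a cycle-free set of edges of $G$ of maximal cardinality that has minimum total weight among these; it is a minimum spanning tree if $G$ is connected. -/

import Mathlib

open scoped ENNReal

noncomputable section

/-! Quantum query programs

The input is a black box `x : Q → A`.  A query is the unitary
`|q, a, z⟩ ↦ |q, a + x q, z⟩`, where `z` ranges over the basis of an arbitrary finite workspace. -/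

/-- Pure states of the query, answer and workspace registers. -/
abbrev QState (Q A Z : Type) [Fintype Q] [Fintype A] [Fintype Z] : Type :=
  EuclideanSpace ℂ (Q × A × Z)

/-- The query as a permutation of the computational basis. -/
def queryEquiv {Q A : Type} (Z : Type) [AddCommGroup A] (x : Q → A) :
    (Q × A × Z) ≃ (Q × A × Z) where
  toFun b := (b.1, b.2.1 + x b.1, b.2.2)
  invFun b := (b.1, b.2.1 - x b.1, b.2.2)
  left_inv b := by simp
  right_inv b := by simp

/-- The query as a unitary operator. -/
def queryUnitary {Q A : Type} (Z : Type) [Fintype Q] [Fintype A] [Fintype Z] [AddCommGroup A]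
    (x : Q → A) : QState Q A Z ≃ₗᵢ[ℂ] QState Q A Z :=
  LinearIsometryEquiv.piLpCongrLeft 2 ℂ ℂ (queryEquiv Z x)

/-- A quantum circuit: a normalized initial state, and a list of input-independent unitaries.
Exactly one query is made before each unitary of the list. -/
structure QCircuit (Q A Z : Type) [Fintype Q] [Fintype A] [Fintype Z] where
  init : QState Q A Z
  norm_init : ‖init‖ = 1
  gates : List (QState Q A Z ≃ₗᵢ[ℂ] QState Q A Z)

namespace QCircuit

variable {Q A Z : Type} [Fintype Q] [Fintype A] [Fintype Z] [AddCommGroup A]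

/-- The state after the circuit has been run on input `x`. -/
def finalState (c : QCircuit Q A Z) (x : Q → A) : QState Q A Z :=
  c.gates.foldl (fun ψ U => U (queryUnitary Z x ψ)) c.init

theorem norm_finalState (c : QCircuit Q A Z) (x : Q → A) : ‖c.finalState x‖ = 1 := by
  have h : ∀ (l : List (QState Q A Z ≃ₗᵢ[ℂ] QState Q A Z)) (ψ : QState Q A Z),
      ‖l.foldl (fun ψ U => U (queryUnitary Z x ψ)) ψ‖ = ‖ψ‖ := by
    intro l
    induction l with
    | nil => intro ψ; rfl
    | cons U l ih =>
      intro ψ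
      rw [List.foldl_cons, ih, LinearIsometryEquiv.norm_map, LinearIsometryEquiv.norm_map]
  rw [finalState, h, c.norm_init]

/-- Measurement of the final state in the computational basis. -/
def measure (c : QCircuit Q A Z) (x : Q → A) : PMF (Q × A × Z) :=
  PMF.ofFintype (fun b => ENNReal.ofReal (‖c.finalState x b‖ ^ 2)) (by
    rw [← ENNReal.ofReal_sum_of_nonneg (fun _ _ => sq_nonneg _),
      ← EuclideanSpace.norm_sq_eq, norm_finalState]
    simp)

end QCircuit

/-- Quantum query programs with classical control: a program can return a result, draw a uniformly
random number from `{0, …, M}`, or run a quantum circuit, measure all its registers and continue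
depending on the outcome.  A program has access to its input only through the queries. -/
inductive QProg (Q A : Type) [Fintype Q] [Fintype A] (R : Type) : Type 1
  | ret (r : R) : QProg Q A R
  | rand (M : ℕ) (k : Fin (M + 1) → QProg Q A R) : QProg Q A R
  | block (Z : Type) [Fintype Z] (c : QCircuit Q A Z) (k : Q × A × Z → QProg Q A R) : QProg Q A R

namespace QProg

variable {Q A : Type} [Fintype Q] [Fintype A]

/-- Sequential composition. -/
def bind {R S : Type} : QProg Q A R → (R → QProg Q A S) → QProg Q A S
  | ret r, k => k r
  | rand M k', k => rand M fun j => (k' j).bind k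
  | block Z c k', k => block Z c fun o => (k' o).bind k

/-- The joint distribution of the result and the number of queries on input `x`. -/
def run {R : Type} [AddCommGroup A] (x : Q → A) : QProg Q A R → PMF (R × ℕ)
  | ret r => PMF.pure (r, 0)
  | rand M k => (PMF.uniformOfFintype (Fin (M + 1))).bind fun j => (k j).run x
  | block _ c k =>
      (c.measure x).bind fun o => ((k o).run x).map fun p => (p.1, p.2 + c.gates.length)

/-- The probability that on input `x` the result lies in `S`. -/
def prob {R : Type} [AddCommGroup A] (p : QProg Q A R) (x : Q → A) (S : Set R) : ℝ≥0∞ :=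
  (p.run x).toOuterMeasure {o | o.1 ∈ S}

/-- On input `x`, every run of the program makes at most `B` queries. -/
def QueriesAtMost {R : Type} [AddCommGroup A] (p : QProg Q A R) (x : Q → A) (B : ℝ) : Prop :=
  ∀ o ∈ (p.run x).support, (o.2 : ℝ) ≤ B

end QProg

/-! The quantum search algorithm for an unknown number of solutions -/

section Search

variable {Q A : Type} [Fintype Q] [Fintype A] [AddCommGroup A]

open Classical in
/-- The uniform superposition of all `|q, 0⟩`. -/
def uniformState (Q A : Type) [Fintype Q] [Fintype A] [AddCommGroup A] : QState Q A Unit :=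
  WithLp.toLp 2 fun b => if b.2.1 = 0 then (((√(Fintype.card Q : ℝ))⁻¹ : ℝ) : ℂ) else 0

theorem norm_uniformState (Q A : Type) [Fintype Q] [Fintype A] [AddCommGroup A] [Nonempty Q] :
    ‖uniformState Q A‖ = 1 := by
  classical
  have hN : (0 : ℝ) < Fintype.card Q := by exact_mod_cast Fintype.card_pos
  have h : ‖uniformState Q A‖ ^ 2 = 1 := by
    rw [EuclideanSpace.norm_sq_eq]
    have h1 : ∀ b : Q × A × Unit, ‖uniformState Q A b‖ ^ 2
        = if b.2.1 = 0 then ((Fintype.card Q : ℝ))⁻¹ else 0 := by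
      intro b
      simp only [uniformState]
      split_ifs
      · rw [Complex.norm_real, Real.norm_eq_abs, sq_abs, inv_pow, Real.sq_sqrt hN.le]
      · simp
    simp only [h1, Fintype.sum_prod_type]
    simp [hN.ne']
  exact (pow_eq_one_iff_of_nonneg (norm_nonneg _) two_ne_zero).1 h

open Classical in
/-- `|q, a⟩ ↦ -|q, -a⟩` if `F (q, a)` holds and `|q, a⟩ ↦ |q, -a⟩` otherwise.
Placed between two queries it maps `|q, 0⟩` to `±|q, 0⟩`, with a sign `-` iff `F (q, x q)`. -/
def phaseNeg (F : Q × A → Prop) : QState Q A Unit ≃ₗᵢ[ℂ] QState Q A Unit :=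
  (LinearIsometryEquiv.piLpCongrRight 2 fun b : Q × A × Unit =>
      if F (b.1, b.2.1) then LinearIsometryEquiv.neg ℂ (E := ℂ)
      else LinearIsometryEquiv.refl ℂ ℂ).trans
    (LinearIsometryEquiv.piLpCongrLeft 2 ℂ ℂ
      ((Equiv.refl Q).prodCongr ((Equiv.neg A).prodCongr (Equiv.refl Unit))))

/-- The reflection `2 |s⟩⟨s| - 1` in the uniform state. -/
def diffusion (Q A : Type) [Fintype Q] [Fintype A] [AddCommGroup A] :
    QState Q A Unit ≃ₗᵢ[ℂ] QState Q A Unit :=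
  (Submodule.span ℂ {uniformState Q A}).reflection

/-- `j` Grover iterations for `F`, starting in the uniform state and followed by one query that
reads the value at the index found. There are `2 * j + 1` queries in total. -/
def groverCircuit [Nonempty Q] (F : Q × A → Prop) (j : ℕ) : QCircuit Q A Unit where
  init := uniformState Q A
  norm_init := norm_uniformState Q A
  gates := (List.replicate j [phaseNeg F, diffusion Q A]).flatten ++
    [LinearIsometryEquiv.refl ℂ (QState Q A Unit)]

open Classical in
/-- Search for an index `q` such that `F (q, x q)`, without knowledge of the number of solutions:
in the trial number `s = 0, 1, …` a random number of Grover iterations less than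
`min ((6/5) ^ s) √|Q|` is made. The search is interrupted before a trial that would exceed the query
budget. The result is the pair `(q, x q)` found, if any, with the remaining budget.
As every trial costs at least one query, `fuel = budget` is no restriction. -/
def searchFrom [Nonempty Q] (F : Q × A → Prop) :
    (fuel s budget : ℕ) → QProg Q A (Option (Q × A) × ℕ)
  | 0, _, _ => .ret (none, 0)
  | fuel + 1, s, budget =>
    .rand (⌈min ((6 / 5 : ℝ) ^ s) √(Fintype.card Q : ℝ)⌉₊ - 1) fun j =>
      if budget < 2 * (j : ℕ) + 1 then .ret (none, 0)
      else .block Unit (groverCircuit F j) fun o =>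
        if F (o.1, o.2.1) then .ret (some (o.1, o.2.1), budget - (2 * (j : ℕ) + 1))
        else searchFrom F fuel (s + 1) (budget - (2 * (j : ℕ) + 1))

open Classical in
/-- The search algorithm; on an empty domain it gives up at once. -/
def search (F : Q × A → Prop) (budget : ℕ) : QProg Q A (Option (Q × A) × ℕ) :=
  if _h : Nonempty Q then searchFrom F budget 0 budget else .ret (none, 0)

end Search

/-! Finding the `d` smallest values of different type

An item is an index together with its queried value; `f` is the value and `g` the type of an item.
The current selection consists of `d` items of different type; `I` is the set of its genuine items,
and the other `d - I.card` ones are artificial: they have private types and the value `⊤`. -/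

section DSmallest

variable {Q A T : Type} [Fintype Q] [Fintype A] [AddCommGroup A]

/-- The item `o` is good for the selection: it improves an item of the same type, or it is of a type
not in the selection and smaller than some item of the selection. -/
def IsGood (f : Q × A → ℕ∞) (g : Q × A → T) (d : ℕ) (I : Finset (Q × A)) (o : Q × A) : Prop :=
  (∃ i ∈ I, g i = g o ∧ f o < f i) ∨
    ((∀ i ∈ I, g i ≠ g o) ∧ ((I.card < d ∧ f o < ⊤) ∨ ∃ i ∈ I, f o < f i))

open Classical in
/-- Replace the item of the same type as `o` by `o` if there is one, and otherwise replace an item of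
largest value by `o` (an artificial one, if there is one). -/
def improve (f : Q × A → ℕ∞) (g : Q × A → T) (d : ℕ) (I : Finset (Q × A)) (o : Q × A) :
    Finset (Q × A) :=
  if ∃ i ∈ I, g i = g o then insert o (I.filter fun i => g i ≠ g o)
  else if I.card < d then insert o I
  else if h : I.Nonempty then insert o (I.erase (I.exists_max_image f h).choose)
  else I

/-- The greedy loop: search for a good item and improve the selection, until the query budget is
used up. Every pass costs at least one query, so `fuel = budget` is no restriction. -/
def dSmallestFrom (f : Q × A → ℕ∞) (g : Q × A → T) (d : ℕ) :
    (fuel : ℕ) → (I : Finset (Q × A)) → (budget : ℕ) → QProg Q A (Finset (Q × A))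
  | 0, I, _ => .ret I
  | fuel + 1, I, budget =>
    (search (IsGood f g d I) budget).bind fun r =>
      match r with
      | (none, _) => .ret I
      | (some o, budget') => dSmallestFrom f g d fuel (improve f g d I o) budget'

/-- Find the `d` smallest values of different type, interrupted after `budget` queries; the initial
selection has artificial items only. -/
def dSmallest (f : Q × A → ℕ∞) (g : Q × A → T) (d budget : ℕ) : QProg Q A (Finset (Q × A)) :=
  dSmallestFrom f g d budget ∅ budget

end DSmallest

/-! The quantum version of Borůvka's algorithm -/

/-- How the black box presents a weighted graph on `V`: the index `q` with the answer `a` is the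
directed pair from `src q` to `tgt q a`, of weight `wt q a` (`⊤` if it is not an edge). -/
structure Presentation (V Q A : Type) where
  src : Q → V
  tgt : Q → A → V
  wt : Q → A → ℕ∞

section Boruvka

variable {V Q A : Type} [Fintype V] [Fintype Q] [Fintype A] [AddCommGroup A]

/-- The graph on `V` with the edge set `F`. -/
abbrev edgeGraph (F : Finset (Sym2 V)) : SimpleGraph V := SimpleGraph.fromEdgeSet (F : Set (Sym2 V))

/-- The number of trees of the forest `F`, isolated vertices included. -/
def numTrees (F : Finset (Sym2 V)) : ℕ := Nat.card (edgeGraph F).ConnectedComponent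

open Classical in
/-- The weight of a directed edge between two different trees of `F`, and `⊤` for other pairs. -/
def leavingWeight (P : Presentation V Q A) (F : Finset (Sym2 V)) (o : Q × A) : ℕ∞ :=
  if (edgeGraph F).Reachable (P.src o.1) (P.tgt o.1 o.2) then ⊤ else P.wt o.1 o.2

/-- The tree of `F` that contains the source of a directed edge. -/
def sourceTree (P : Presentation V Q A) (F : Finset (Sym2 V)) (o : Q × A) :
    (edgeGraph F).ConnectedComponent :=
  (edgeGraph F).connectedComponentMk (P.src o.1)

open Classical in
/-- Add an edge to the forest unless it joins two vertices of one tree. -/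
def addEdge (P : Presentation V Q A) (F : Finset (Sym2 V)) (o : Q × A) : Finset (Sym2 V) :=
  if (edgeGraph F).Reachable (P.src o.1) (P.tgt o.1 o.2) then F
  else insert s(P.src o.1, P.tgt o.1 o.2) F

/-- The query budget `(ℓ + 2) c √(k N)` of iteration `ℓ`, where `N = |Q|` and `k` is the number of
trees, or `n / 2 ^ (ℓ - 1)` if that is smaller (as it can be for disconnected graphs). -/
def roundBudget (Q : Type) [Fintype Q] (c : ℝ) (l : ℕ) (F : Finset (Sym2 V)) : ℕ :=
  ⌊((l : ℝ) + 2) * c *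
    √(min (numTrees F : ℝ) ((Fintype.card V : ℝ) / 2 ^ (l - 1)) * (Fintype.card Q : ℝ))⌋₊

/-- Iteration `ℓ`: find a minimum weight edge out of each tree and add these edges. -/
def boruvkaRound (P : Presentation V Q A) (c : ℝ) (l : ℕ) (F : Finset (Sym2 V)) :
    QProg Q A (Finset (Sym2 V)) :=
  (dSmallest (leavingWeight P F) (sourceTree P F) (numTrees F) (roundBudget Q c l F)).bind
    fun I => .ret (I.toList.foldl (addEdge P) F)

/-- At most `r` further iterations, beginning with iteration `ℓ`, until there is a single tree. -/
def boruvkaFrom (P : Presentation V Q A) (c : ℝ) :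
    (r l : ℕ) → (F : Finset (Sym2 V)) → QProg Q A (Finset (Sym2 V))
  | 0, _, F => .ret F
  | r + 1, l, F =>
    if numTrees F = 1 then .ret F
    else (boruvkaRound P c l F).bind fun F' => boruvkaFrom P c r (l + 1) F'

/-- The algorithm: at most `⌈log₂ n⌉` iterations, starting with single vertices. -/
def boruvka (P : Presentation V Q A) (c : ℝ) : QProg Q A (Finset (Sym2 V)) :=
  boruvkaFrom P c (Nat.clog 2 (Fintype.card V)) 1 ∅

end Boruvka

/-! Minimum spanning forests -/

section MST

variable {V : Type}

/-- A cycle-free set of edges of `G`. -/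
def IsForestOf (G : SimpleGraph V) (F : Finset (Sym2 V)) : Prop :=
  (F : Set (Sym2 V)) ⊆ G.edgeSet ∧ (edgeGraph F).IsAcyclic

/-- A cycle-free set of edges of maximal cardinality (a spanning tree if `G` is connected). -/
def IsSpanningForest (G : SimpleGraph V) (F : Finset (Sym2 V)) : Prop :=
  IsForestOf G F ∧ ∀ F', IsForestOf G F' → F'.card ≤ F.card

/-- A spanning forest of minimum total weight. -/
def IsMinSpanningForest (G : SimpleGraph V) (w : Sym2 V → ℕ) (F : Finset (Sym2 V)) : Prop :=
  IsSpanningForest G F ∧ ∀ F', IsSpanningForest G F' → ∑ e ∈ F, w e ≤ ∑ e ∈ F', w e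

end MST

/-! The two input models, for graphs on `Fin n` with edge weights at most `W` -/

/-- The adjacency array model, with known degrees: `x ⟨u, j⟩` is the `j`-th neighbour of `u` together
with the weight of the edge. -/
structure IsArrayInput {n W : ℕ} (G : SimpleGraph (Fin n)) (w : Sym2 (Fin n) → ℕ)
    (deg : Fin n → ℕ) (x : (Σ u : Fin n, Fin (deg u)) → Fin n × Fin (W + 1)) : Prop where
  simple : ∀ u, Function.Injective fun j : Fin (deg u) => (x ⟨u, j⟩).1
  adj : ∀ u v, G.Adj u v ↔ ∃ j : Fin (deg u), (x ⟨u, j⟩).1 = v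
  weight : ∀ (u : Fin n) (j : Fin (deg u)), ((x ⟨u, j⟩).2 : ℕ) = w s(u, (x ⟨u, j⟩).1)

/-- Entries of weight matrices: the largest element of `Fin (W + 2)` stands for `∞`. -/
def decodeEntry {W : ℕ} (a : Fin (W + 2)) : ℕ∞ :=
  if a = Fin.last (W + 1) then ⊤ else ((a : ℕ) : ℕ∞)

open Classical in
/-- The adjacency matrix model: `x (u, v)` is the weight of the edge between `u` and `v`, or `∞` if
there is none. -/
def IsMatrixInput {n W : ℕ} (G : SimpleGraph (Fin n)) (w : Sym2 (Fin n) → ℕ)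
    (x : Fin n × Fin n → Fin (W + 2)) : Prop :=
  ∀ u v, decodeEntry (x (u, v)) = if G.Adj u v then (w s(u, v) : ℕ∞) else ⊤

/-- Directed edges are numbered by the entries of the arrays. -/
def arrayPresentation (n W : ℕ) (deg : Fin n → ℕ) :
    Presentation (Fin n) (Σ u : Fin n, Fin (deg u)) (Fin n × Fin (W + 1)) where
  src q := q.1
  tgt _ a := a.1
  wt _ a := ((a.2 : ℕ) : ℕ∞)

/-- Directed edges are numbered by the entries of the matrix. -/
def matrixPresentation (n W : ℕ) : Presentation (Fin n) (Fin n × Fin n) (Fin (W + 2)) where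
  src q := q.1
  tgt q _ := q.2
  wt _ a := decodeEntry a

end

/-! The query bound is deterministic because every round has a budget: round ℓ costs at most
(ℓ+2)c√(nN/2^(ℓ-1)), and these bounds sum to O(√(nN)). All other work concerns the failure
probability.

The core is an exponential tail for one interrupted run, `expect_dSmallest_le`: with budget b it
fails with probability at most 2 exp(-b/(1296√(τN))), where τ bounds the number of types of finite
value. The factor ℓ+2 in the budget then makes round ℓ fail with probability at most 2^-(ℓ+2), and
these add up to at most 1/4. Instead of expected running times, the induction carries failure bounds
of the form (1 + λ · cost) exp(-λb). As long as the coefficient is at most 2 and λc ≤ 1, spending c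
queries raises it by at most 4λc, since e^(λc) ≤ 1 + 2λc.

Two estimates bound the cost. By the rotation picture of Grover's algorithm, a random number of
iterations below m ≥ √(N/M) finds one of M solutions with probability at least 1/4
(`quarter_le_sum_sin_sq`), so a search costs O(√(N/M)) on average. The item found is uniform among
the M good ones and on average eliminates at least (M+τ)/(2τ) of them (`card_mul_add_le_sum_card`).
Hence `potential` drops on average by at least 1/(2√M), which pays for the search, and it never
exceeds 4√τ.

The classical part is an exchange argument that tolerates equal weights (`IsPartialRound.addEdge`).
A tree that still has a leaving edge before round ℓ has at least 2^(ℓ-1) vertices. This bounds τ by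
n/2^(ℓ-1) and makes ⌈log₂ n⌉ rounds suffice, for disconnected graphs too. -/

set_option linter.unusedSectionVars false

/-! ### Expectations, probabilities and query counts of programs -/

namespace QProg

variable {Q A : Type} [Fintype Q] [Fintype A] [AddCommGroup A] {R S : Type}

/-- The expected value of a function of the result of a program on input `x`. -/
noncomputable def expect (x : Q → A) (h : R → ℝ) : QProg Q A R → ℝ
  | ret r => h r
  | rand M k => (∑ j, (k j).expect x h) / (M + 1)
  | block _ c k => ∑ o, ‖c.finalState x o‖ ^ 2 * (k o).expect x h

theorem sum_norm_sq_finalState {Z : Type} [Fintype Z] (c : QCircuit Q A Z) (x : Q → A) :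
    ∑ o, ‖c.finalState x o‖ ^ 2 = 1 := by
  rw [← EuclideanSpace.norm_sq_eq, c.norm_finalState, one_pow]

theorem expect_bind (x : Q → A) (h : S → ℝ) (p : QProg Q A R) (k : R → QProg Q A S) :
    (p.bind k).expect x h = p.expect x fun r => (k r).expect x h := by
  induction p with
  | ret r => rfl
  | rand M k' ih => simp only [bind, expect, ih]
  | block Z c k' ih => simp only [bind, expect, ih]

theorem expect_mono {x : Q → A} {h h' : R → ℝ} (hh : ∀ r, h r ≤ h' r) (p : QProg Q A R) :
    p.expect x h ≤ p.expect x h' := by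
  induction p with
  | ret r => exact hh r
  | rand M k' ih =>
    simp only [expect]
    exact div_le_div_of_nonneg_right (Finset.sum_le_sum fun j _ => ih j) (by positivity)
  | block Z c k' ih =>
    simp only [expect]
    exact Finset.sum_le_sum fun o _ => mul_le_mul_of_nonneg_left (ih o) (sq_nonneg _)

theorem expect_add (x : Q → A) (h h' : R → ℝ) (p : QProg Q A R) :
    p.expect x (fun r => h r + h' r) = p.expect x h + p.expect x h' := by
  induction p with
  | ret r => rfl
  | rand M k' ih => simp only [expect, ih, Finset.sum_add_distrib, add_div]
  | block Z c k' ih => simp only [expect, ih, mul_add, Finset.sum_add_distrib]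

theorem expect_const (x : Q → A) (a : ℝ) (p : QProg Q A R) : p.expect x (fun _ => a) = a := by
  induction p with
  | ret r => rfl
  | rand M k' ih =>
    simp only [expect, ih, Finset.sum_const, Finset.card_univ, Fintype.card_fin, nsmul_eq_mul]
    push_cast
    field_simp
  | block Z c k' ih =>
    simp only [expect, ih, ← Finset.sum_mul, sum_norm_sq_finalState, one_mul]

theorem expect_nonneg {x : Q → A} {h : R → ℝ} (hh : ∀ r, 0 ≤ h r) (p : QProg Q A R) :
    0 ≤ p.expect x h :=
  (expect_const x 0 p).symm.le.trans (expect_mono hh p)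

theorem expect_le_of_le {x : Q → A} {h : R → ℝ} {a : ℝ} (hh : ∀ r, h r ≤ a) (p : QProg Q A R) :
    p.expect x h ≤ a :=
  (expect_mono hh p).trans (expect_const x a p).le

/-- All later estimates concern `expect`, a real-valued recursion over the program; this ties it to
the `PMF` semantics. -/
theorem prob_eq (x : Q → A) (T : Set R) (p : QProg Q A R) :
    p.prob x T = ENNReal.ofReal (p.expect x (T.indicator 1)) := by
  have h0 : ∀ p : QProg Q A R, 0 ≤ p.expect x (T.indicator 1) :=
    expect_nonneg fun r => Set.indicator_nonneg (fun _ _ => zero_le_one) r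
  induction p with
  | ret r =>
    simp only [prob, run, expect]
    by_cases hr : r ∈ T <;> simp [hr]
  | rand M k ih =>
    simp only [prob, run, PMF.toOuterMeasure_bind_apply, expect] at ih ⊢
    simp only [ih, tsum_fintype, PMF.uniformOfFintype_apply, Fintype.card_fin]
    rw [div_eq_inv_mul, ENNReal.ofReal_mul (by positivity),
      ENNReal.ofReal_sum_of_nonneg (fun j _ => h0 _), Finset.mul_sum,
      ENNReal.ofReal_inv_of_pos (by positivity)]
    congr! 3
    rw [← Nat.cast_succ, ENNReal.ofReal_natCast]
  | block Z c k ih =>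
    simp only [prob, run, PMF.toOuterMeasure_bind_apply, PMF.toOuterMeasure_map_apply, expect]
      at ih ⊢
    rw [tsum_fintype, ENNReal.ofReal_sum_of_nonneg
      (fun o _ => mul_nonneg (sq_nonneg _) (h0 _))]
    refine Finset.sum_congr rfl fun o _ => ?_
    rw [ENNReal.ofReal_mul (sq_nonneg _), ← ih]
    rfl

theorem le_prob_of_expect_compl_le {x : Q → A} {T : Set R} {p : QProg Q A R} {a : ℝ}
    (h : p.expect x (Tᶜ.indicator 1) ≤ a) : ENNReal.ofReal (1 - a) ≤ p.prob x T := by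
  rw [prob_eq]
  apply ENNReal.ofReal_le_ofReal
  have h1 := expect_add x (T.indicator 1) (Tᶜ.indicator 1) p
  have h2 : (fun r => T.indicator (1 : R → ℝ) r + Tᶜ.indicator 1 r) = fun _ => 1 := by
    funext r
    exact congrFun (Set.indicator_self_add_compl T (1 : R → ℝ)) r
  rw [h2, expect_const] at h1
  linarith

theorem mem_support_run_ret {x : Q → A} {r : R} {o : R × ℕ} :
    o ∈ ((ret r : QProg Q A R).run x).support ↔ o = (r, 0) := by
  simp [run]

theorem mem_support_run_rand {x : Q → A} {M : ℕ} {k : Fin (M + 1) → QProg Q A R} {o : R × ℕ} :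
    o ∈ ((rand M k).run x).support ↔ ∃ j, o ∈ ((k j).run x).support := by
  simp only [run, PMF.mem_support_bind_iff, PMF.mem_support_uniformOfFintype,
    true_and]

theorem mem_support_run_block {x : Q → A} {Z : Type} [Fintype Z] {c : QCircuit Q A Z}
    {k : Q × A × Z → QProg Q A R} {o : R × ℕ} (h : o ∈ ((block Z c k).run x).support) :
    ∃ b, ∃ o' ∈ ((k b).run x).support, o = (o'.1, o'.2 + c.gates.length) := by
  simp only [run, PMF.mem_support_bind_iff, PMF.mem_support_map_iff] at h
  obtain ⟨b, -, o', h1, h2⟩ := h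
  exact ⟨b, o', h1, h2.symm⟩

theorem mem_support_run_bind {x : Q → A} {p : QProg Q A R} {k : R → QProg Q A S} {o : S × ℕ}
    (h : o ∈ ((p.bind k).run x).support) :
    ∃ o₁ ∈ (p.run x).support, ∃ o₂ ∈ ((k o₁.1).run x).support, o = (o₂.1, o₁.2 + o₂.2) := by
  induction p generalizing o with
  | ret r => exact ⟨(r, 0), mem_support_run_ret.2 rfl, o, h, by simp⟩
  | rand M k' ih =>
    obtain ⟨j, hj⟩ := mem_support_run_rand.1 h
    obtain ⟨o₁, h1, h2⟩ := ih j hj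
    exact ⟨o₁, mem_support_run_rand.2 ⟨j, h1⟩, h2⟩
  | block Z c k' ih =>
    simp only [bind, run, PMF.mem_support_bind_iff, PMF.mem_support_map_iff] at h ⊢
    obtain ⟨b, hb, o', ho', rfl⟩ := h
    obtain ⟨o₁, h1, o₂, h2, rfl⟩ := ih b ho'
    exact ⟨(o₁.1, o₁.2 + c.gates.length), ⟨b, hb, o₁, h1, rfl⟩, o₂, h2, by simp; omega⟩

end QProg

/-! ### Grover iterations as rotations of a plane -/

section Grover

variable {Q A : Type} [Fintype Q] [Fintype A] [AddCommGroup A]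

open Classical in
/-- The state with real amplitude `a` at the solutions of `F` and `b` at the other indices. -/
noncomputable def twoLevelState (F : Q × A → Prop) (x : Q → A) (a b : ℝ) : QState Q A Unit :=
  WithLp.toLp 2 fun o => if o.2.1 = 0 then (((if F (o.1, x o.1) then a else b : ℝ)) : ℂ) else 0

open Classical in
/-- The indices with the property `F` for the input `x`. -/
noncomputable def solutions (F : Q × A → Prop) (x : Q → A) : Finset Q :=
  Finset.univ.filter fun q => F (q, x q)

theorem mem_solutions {F : Q × A → Prop} {x : Q → A} {q : Q} :
    q ∈ solutions F x ↔ F (q, x q) := by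
  simp [solutions]

theorem queryUnitary_apply {Z : Type} [Fintype Z] (x : Q → A) (ψ : QState Q A Z)
    (o : Q × A × Z) : queryUnitary Z x ψ o = ψ (o.1, o.2.1 - x o.1, o.2.2) := rfl

open Classical in
theorem phaseNeg_apply (F : Q × A → Prop) (ψ : QState Q A Unit) (o : Q × A × Unit) :
    phaseNeg F ψ o = if F (o.1, -o.2.1) then -ψ (o.1, -o.2.1, o.2.2)
      else ψ (o.1, -o.2.1, o.2.2) := by
  have h : phaseNeg F ψ o = (if F (o.1, -o.2.1) then LinearIsometryEquiv.neg ℂ (E := ℂ)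
      else LinearIsometryEquiv.refl ℂ ℂ) (ψ (o.1, -o.2.1, o.2.2)) := rfl
  rw [h]
  split_ifs <;> simp

/-- The first query writes `x q` into the zero answer register, `phaseNeg` turns it into `-x q`, and
the second query cancels it, so only the sign remains. -/
theorem query_phaseNeg_query (F : Q × A → Prop) (x : Q → A) (a b : ℝ) :
    queryUnitary Unit x (phaseNeg F (queryUnitary Unit x (twoLevelState F x a b)))
      = twoLevelState F x (-a) b := by
  classical
  ext ⟨q, c, u⟩
  rw [queryUnitary_apply, phaseNeg_apply, queryUnitary_apply]
  simp only [twoLevelState, neg_sub, sub_sub_cancel_left, neg_eq_zero]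
  by_cases hc : c = 0
  · subst hc
    by_cases hF : F (q, x q) <;> simp [hF]
  · simp [hc]

theorem inner_uniformState_twoLevelState [Nonempty Q] (F : Q × A → Prop) (x : Q → A) (a b : ℝ) :
    inner ℂ (uniformState Q A) (twoLevelState F x a b) =
      (((√(Fintype.card Q : ℝ))⁻¹ * ((solutions F x).card * a
        + (Fintype.card Q - (solutions F x).card) * b) : ℝ) : ℂ) := by
  classical
  have h : ∀ q : Q, (if F (q, x q) then a else b : ℝ) = b + if F (q, x q) then a - b else 0 := by
    intro q; split_ifs <;> ring
  rw [PiLp.inner_apply, Fintype.sum_prod_type]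
  simp only [uniformState, twoLevelState, Fintype.sum_prod_type, Finset.univ_unique,
    Finset.sum_singleton]
  have h2 : ∀ q : Q, (∑ c : A, inner ℂ
      (if c = 0 then (((√(Fintype.card Q : ℝ))⁻¹ : ℝ) : ℂ) else 0)
      (if c = 0 then (((if F (q, x q) then a else b : ℝ)) : ℂ) else 0))
      = (((√(Fintype.card Q : ℝ))⁻¹ * (if F (q, x q) then a else b) : ℝ) : ℂ) := by
    intro q
    rw [Finset.sum_eq_single 0 (fun c _ hc => by simp [hc]) (by simp)]
    by_cases hF : F (q, x q) <;> simp [hF, mul_comm]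
  rw [Finset.sum_congr rfl fun q _ => h2 q, ← Complex.ofReal_sum, ← Finset.mul_sum]
  congr 2
  simp only [h, Finset.sum_add_distrib, Finset.sum_const, Finset.card_univ, nsmul_eq_mul,
    ← Finset.sum_filter]
  rw [solutions]
  ring

theorem diffusion_twoLevelState [Nonempty Q] (F : Q × A → Prop) (x : Q → A) (a b : ℝ) :
    diffusion Q A (twoLevelState F x a b) = twoLevelState F x
      (2 * ((solutions F x).card * a + (Fintype.card Q - (solutions F x).card) * b)
        / Fintype.card Q - a)
      (2 * ((solutions F x).card * a + (Fintype.card Q - (solutions F x).card) * b)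
        / Fintype.card Q - b) := by
  classical
  have hN : (0 : ℝ) < Fintype.card Q := by exact_mod_cast Fintype.card_pos
  rw [diffusion, Submodule.reflection_singleton_apply, inner_uniformState_twoLevelState,
    norm_uniformState]
  set y : ℝ := (solutions F x).card * a + (Fintype.card Q - (solutions F x).card) * b
  have hy : 2 * ((√(Fintype.card Q : ℝ))⁻¹ * y * (√(Fintype.card Q : ℝ))⁻¹)
      = 2 * y / Fintype.card Q := by
    rw [mul_right_comm, ← mul_inv, Real.mul_self_sqrt hN.le]
    ring
  ext ⟨q, c, u⟩
  simp only [twoLevelState, uniformState, PiLp.sub_apply, PiLp.smul_apply]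
  by_cases hc : c = 0
  · simp only [hc, if_true]
    rw [← hy]
    split_ifs <;> (push_cast; simp)
  · simp [hc]

/-- An iteration is a product of two reflections, hence a rotation by 2θ. The factors √N sin θ and
√N cos θ turn the amplitudes into plane coordinates; keeping them multiplied avoids dividing by a
sine or cosine that may vanish. -/
theorem exists_foldl_grover [Nonempty Q] (F : Q × A → Prop) (x : Q → A) {θ : ℝ}
    (hs : Real.sin θ ^ 2 = (solutions F x).card / Fintype.card Q) (j : ℕ) :
    ∃ a b : ℝ, ((List.replicate j [phaseNeg F, diffusion Q A]).flatten).foldl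
        (fun ψ U => U (queryUnitary Unit x ψ)) (uniformState Q A) = twoLevelState F x a b ∧
      √(Fintype.card Q) * Real.sin θ * a = Real.sin ((2 * j + 1) * θ) ∧
      √(Fintype.card Q) * Real.cos θ * b = Real.cos ((2 * j + 1) * θ) := by
  have hN : (0 : ℝ) < Fintype.card Q := by exact_mod_cast Fintype.card_pos
  induction j with
  | zero =>
    refine ⟨(√(Fintype.card Q : ℝ))⁻¹, (√(Fintype.card Q : ℝ))⁻¹, ?_, ?_, ?_⟩
    · simp [twoLevelState, uniformState]
    · have := (Real.sqrt_pos.2 hN).ne'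
      simp; field_simp
    · have := (Real.sqrt_pos.2 hN).ne'
      simp; field_simp
  | succ j ih =>
    obtain ⟨a, b, h, ha, hb⟩ := ih
    have hst : ((List.replicate (j + 1) [phaseNeg F, diffusion Q A]).flatten).foldl
        (fun ψ U => U (queryUnitary Unit x ψ)) (uniformState Q A)
          = diffusion Q A (twoLevelState F x (-a) b) := by
      rw [List.replicate_succ', List.flatten_append, List.foldl_append, h]
      simp only [List.flatten_cons, List.flatten_nil, List.append_nil, List.foldl_cons,
        List.foldl_nil]
      rw [query_phaseNeg_query]
    rw [diffusion_twoLevelState] at hst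
    refine ⟨_, _, hst, ?_, ?_⟩
    all_goals
      have hM : ((solutions F x).card : ℝ) = Real.sin θ ^ 2 * Fintype.card Q := by
        rw [hs]; field_simp
      have hcs := Real.sin_sq_add_cos_sq θ
      have e : ((2 * ((j + 1 : ℕ) : ℝ) + 1) * θ) = (2 * j + 1) * θ + 2 * θ := by push_cast; ring
      have hμ : 2 * ((solutions F x).card * (-a) + (Fintype.card Q - (solutions F x).card) * b)
        / (Fintype.card Q : ℝ) = 2 * (Real.cos θ ^ 2 * b - Real.sin θ ^ 2 * a) := by
        rw [hM, show Real.cos θ ^ 2 = 1 - Real.sin θ ^ 2 by linarith]; field_simp; ring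
      rw [hμ, e]
    · rw [Real.sin_add, ← ha, ← hb, Real.cos_two_mul, Real.sin_two_mul,
        show Real.cos θ ^ 2 = 1 - Real.sin θ ^ 2 by linarith]
      linear_combination (-2 * √(Fintype.card Q) * Real.sin θ * b) * hcs
    · rw [Real.cos_add, ← ha, ← hb, Real.cos_two_mul, Real.sin_two_mul]
      ring

-- The last query writes `x q`, so the measured value always belongs to the measured index, and all
-- solutions have the same probability.
open Classical in
theorem exists_groverCircuit_finalState [Nonempty Q] (F : Q × A → Prop) (x : Q → A) {θ : ℝ}
    (hs : Real.sin θ ^ 2 = (solutions F x).card / Fintype.card Q) (j : ℕ) :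
    ∃ a b : ℝ, (solutions F x).card * a ^ 2 = Real.sin ((2 * j + 1) * θ) ^ 2 ∧
      (∀ q, ‖(groverCircuit F j).finalState x (q, x q, ())‖ ^ 2
        = if q ∈ solutions F x then a ^ 2 else b ^ 2) ∧
      ∀ q c, c ≠ x q → (groverCircuit F j).finalState x (q, c, ()) = 0 := by
  have hN : (0 : ℝ) < Fintype.card Q := by exact_mod_cast Fintype.card_pos
  obtain ⟨a, b, h, ha, -⟩ := exists_foldl_grover F x hs j
  have hf : (groverCircuit F j).finalState x = queryUnitary Unit x (twoLevelState F x a b) := by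
    rw [QCircuit.finalState]
    simp only [groverCircuit, List.foldl_append, h]
    rfl
  refine ⟨a, b, ?_, fun q => ?_, fun q c hc => ?_⟩
  · rw [← ha, mul_pow, mul_pow, Real.sq_sqrt hN.le, hs]
    field_simp
  · rw [hf, queryUnitary_apply]
    simp only [twoLevelState, sub_self, if_true]
    rw [Complex.norm_real, Real.norm_eq_abs, sq_abs]
    simp only [mem_solutions]
    split_ifs <;> rfl
  · rw [hf, queryUnitary_apply]
    simp [twoLevelState, sub_eq_zero, hc]

theorem exists_sin_sq_eq [Nonempty Q] (F : Q × A → Prop) (x : Q → A) :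
    ∃ θ, 0 ≤ θ ∧ θ ≤ Real.pi / 2 ∧
      Real.sin θ ^ 2 = (solutions F x).card / (Fintype.card Q : ℝ) := by
  have hN : (0 : ℝ) < Fintype.card Q := by exact_mod_cast Fintype.card_pos
  have h1 : ((solutions F x).card / (Fintype.card Q : ℝ)) ≤ 1 := by
    rw [div_le_one hN]
    exact_mod_cast Finset.card_le_univ _
  have h0 : 0 ≤ ((solutions F x).card / (Fintype.card Q : ℝ)) := by positivity
  refine ⟨Real.arcsin √((solutions F x).card / (Fintype.card Q : ℝ)),
    Real.arcsin_nonneg.2 (Real.sqrt_nonneg _), Real.arcsin_le_pi_div_two _, ?_⟩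
  rw [Real.sin_arcsin (by linarith [Real.sqrt_nonneg ((solutions F x).card / (Fintype.card Q : ℝ))])
    (Real.sqrt_le_one.2 h1), Real.sq_sqrt h0]

theorem sum_groverCircuit_eq [Nonempty Q] (F : Q × A → Prop) (x : Q → A) (j : ℕ)
    (h : Q × A × Unit → ℝ) :
    ∑ o, ‖(groverCircuit F j).finalState x o‖ ^ 2 * h o
      = ∑ q, ‖(groverCircuit F j).finalState x (q, x q, ())‖ ^ 2 * h (q, x q, ()) := by
  classical
  obtain ⟨θ, -, -, hs⟩ := exists_sin_sq_eq F x
  obtain ⟨a, b, -, -, h0⟩ := exists_groverCircuit_finalState F x hs j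
  rw [Fintype.sum_prod_type]
  refine Finset.sum_congr rfl fun q _ => ?_
  rw [Fintype.sum_prod_type]
  simp only [Finset.univ_unique, Finset.sum_singleton]
  exact Finset.sum_eq_single (x q) (fun c _ hc => by
    rw [show (default : Unit) = () from rfl, h0 q c hc]; simp) (by simp)

/-- The outcome of a Grover circuit is a uniformly random solution with probability
`sin² ((2 j + 1) θ)`. -/
theorem sum_groverCircuit_le [Nonempty Q] {F : Q × A → Prop} {x : Q → A} {θ : ℝ}
    (hM : (solutions F x).Nonempty)
    (hs : Real.sin θ ^ 2 = (solutions F x).card / Fintype.card Q) (j : ℕ)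
    {h : Q × A × Unit → ℝ} {H : ℝ} (hH : ∀ q, ¬ F (q, x q) → h (q, x q, ()) ≤ H) :
    ∑ o, ‖(groverCircuit F j).finalState x o‖ ^ 2 * h o
      ≤ Real.sin ((2 * j + 1) * θ) ^ 2
          * ((∑ q ∈ solutions F x, h (q, x q, ())) / (solutions F x).card)
        + (1 - Real.sin ((2 * j + 1) * θ) ^ 2) * H := by
  classical
  obtain ⟨a, b, ha, hq, -⟩ := exists_groverCircuit_finalState F x hs j
  have hM' : (0 : ℝ) < (solutions F x).card := by exact_mod_cast hM.card_pos
  have h1 := QProg.sum_norm_sq_finalState (groverCircuit F j) x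
  have h2 := sum_groverCircuit_eq F x j fun _ => 1
  simp only [mul_one] at h2
  rw [h1, ← Finset.sum_add_sum_compl (solutions F x)] at h2
  rw [sum_groverCircuit_eq, ← Finset.sum_add_sum_compl (solutions F x)]
  have e1 : ∀ g : Q → ℝ, ∑ q ∈ solutions F x, ‖(groverCircuit F j).finalState x (q, x q, ())‖ ^ 2
      * g q = a ^ 2 * ∑ q ∈ solutions F x, g q := by
    intro g
    rw [Finset.mul_sum]
    exact Finset.sum_congr rfl fun q hq' => by rw [hq, if_pos hq']
  have e2 := e1 fun _ => 1
  simp only [mul_one, Finset.sum_const, nsmul_eq_mul] at e2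
  rw [e2, mul_comm (a ^ 2), ha] at h2
  rw [e1 fun q => h (q, x q, ())]
  refine add_le_add (le_of_eq ?_) ?_
  · generalize ∑ q ∈ solutions F x, h (q, x q, ()) = S
    have e3 : ((solutions F x).card : ℝ) * (S / (solutions F x).card) = S := by
      rw [mul_div_assoc', mul_div_cancel_left₀ _ hM'.ne']
    rw [← ha]
    linear_combination (-a ^ 2) * e3
  · rw [show (1 - Real.sin ((2 * j + 1) * θ) ^ 2) = ∑ q ∈ (solutions F x)ᶜ,
      ‖(groverCircuit F j).finalState x (q, x q, ())‖ ^ 2 by linarith, Finset.sum_mul]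
    refine Finset.sum_le_sum fun q hq' => mul_le_mul_of_nonneg_left (hH q ?_) (sq_nonneg _)
    rwa [Finset.mem_compl, mem_solutions] at hq'

end Grover

/-! ### Success probability and cost of a randomized trial -/

section Averages

theorem two_mul_sin_mul_sum_cos (θ : ℝ) (m : ℕ) :
    2 * Real.sin (2 * θ) * ∑ j ∈ Finset.range m, Real.cos ((4 * j + 2) * θ)
      = Real.sin (4 * m * θ) := by
  induction m with
  | zero => simp
  | succ m ih =>
    rw [Finset.sum_range_succ, mul_add, ih]
    have e1 : 4 * ((m + 1 : ℕ) : ℝ) * θ = (4 * m + 2) * θ + 2 * θ := by push_cast; ring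
    have e2 : 4 * (m : ℝ) * θ = (4 * m + 2) * θ - 2 * θ := by ring
    rw [e1, e2, Real.sin_add, Real.sin_sub]
    ring

/-- If 4mφ ≤ π, the closed form sin(4mφ)/(2 sin 2φ) is nonnegative. Otherwise Jordan's inequality
gives m sin 2φ ≥ 1, and its modulus is at most m/2. No lower bound on m is assumed, because φ will
be π/2 - θ, which may be tiny. -/
theorem neg_half_le_sum_cos {φ : ℝ} (h0 : 0 ≤ φ) (h1 : φ ≤ Real.pi / 4) (m : ℕ) :
    -(m / 2 : ℝ) ≤ ∑ j ∈ Finset.range m, Real.cos ((4 * j + 2) * φ) := by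
  have hpi := Real.pi_pos
  have hsum := two_mul_sin_mul_sum_cos φ m
  set C := ∑ j ∈ Finset.range m, Real.cos ((4 * j + 2) * φ) with hC
  rcases h0.eq_or_lt with rfl | h0
  · simp only [mul_zero, Real.cos_zero, Finset.sum_const, Finset.card_range, nsmul_eq_mul,
      mul_one] at hC
    rw [hC]
    linarith [Nat.cast_nonneg (α := ℝ) m]
  have hJ : 2 / Real.pi * (2 * φ) ≤ Real.sin (2 * φ) :=
    Real.mul_le_sin (by linarith) (by linarith)
  have hs : 0 < Real.sin (2 * φ) := lt_of_lt_of_le (by positivity) hJ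
  by_cases hm : 4 * m * φ ≤ Real.pi
  · have : 0 ≤ Real.sin (4 * m * φ) := Real.sin_nonneg_of_nonneg_of_le_pi (by positivity) hm
    have hC0 : 0 ≤ C := by
      by_contra hneg
      push Not at hneg
      nlinarith
    linarith [Nat.cast_nonneg (α := ℝ) m]
  · push Not at hm
    have h2 : 1 ≤ m * Real.sin (2 * φ) := by
      refine le_trans ?_ (mul_le_mul_of_nonneg_left hJ (Nat.cast_nonneg m))
      rw [show (m : ℝ) * (2 / Real.pi * (2 * φ)) = 4 * m * φ / Real.pi by ring]
      rw [le_div_iff₀ hpi]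
      linarith
    have h3 := Real.neg_one_le_sin (4 * m * φ)
    by_contra hneg
    push Not at hneg
    nlinarith

theorem sum_cos_le_half {θ : ℝ} (h0 : 0 < θ) (h1 : θ ≤ Real.pi / 4) {m : ℕ}
    (hm : 1 ≤ m * Real.sin θ) :
    ∑ j ∈ Finset.range m, Real.cos ((4 * j + 2) * θ) ≤ m / 2 := by
  have hpi := Real.pi_pos
  have hsum := two_mul_sin_mul_sum_cos θ m
  have hsin : 0 < Real.sin θ := Real.sin_pos_of_pos_of_lt_pi h0 (by linarith)
  have hcos : 1 / 2 ≤ Real.cos θ := by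
    rw [← Real.cos_pi_div_three]
    exact Real.cos_le_cos_of_nonneg_of_le_pi h0.le (by linarith) (by linarith)
  have h2 : Real.sin θ ≤ Real.sin (2 * θ) := by
    rw [Real.sin_two_mul]
    nlinarith
  have h3 : 1 ≤ m * Real.sin (2 * θ) :=
    hm.trans (mul_le_mul_of_nonneg_left h2 (Nat.cast_nonneg m))
  have h4 := Real.sin_le_one (4 * m * θ)
  by_contra hneg
  push Not at hneg
  nlinarith

/-- A random number of Grover iterations less than `m ≥ 1 / sin θ` succeeds with probability at
least `1 / 4`. -/
theorem quarter_le_sum_sin_sq {θ : ℝ} (h0 : 0 < θ) (h1 : θ ≤ Real.pi / 2) {m : ℕ}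
    (hm : 1 ≤ m * Real.sin θ) :
    (m / 4 : ℝ) ≤ ∑ j ∈ Finset.range m, Real.sin ((2 * j + 1) * θ) ^ 2 := by
  have e : ∀ j : ℕ, Real.sin ((2 * j + 1) * θ) ^ 2
      = 1 / 2 - Real.cos ((4 * j + 2) * θ) / 2 := by
    intro j
    rw [Real.sin_sq_eq_half_sub, show 2 * ((2 * (j : ℝ) + 1) * θ) = (4 * j + 2) * θ by ring]
  have hC : ∑ j ∈ Finset.range m, Real.cos ((4 * j + 2) * θ) ≤ m / 2 := by
    rcases le_total θ (Real.pi / 4) with hθ | hθ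
    · exact sum_cos_le_half h0 hθ hm
    -- Reflecting θ to π/2 - θ reverses the sign of every cosine, so the upper bound becomes a lower
    -- bound for a small angle.
    · have e2 : ∀ j : ℕ, Real.cos ((4 * j + 2) * θ)
          = -Real.cos ((4 * j + 2) * (Real.pi / 2 - θ)) := by
        intro j
        rw [show (4 * (j : ℝ) + 2) * (Real.pi / 2 - θ)
          = Real.pi - (4 * j + 2) * θ + j * (2 * Real.pi) by ring, Real.cos_add_nat_mul_two_pi,
          Real.cos_pi_sub, neg_neg]
      simp only [e2, Finset.sum_neg_distrib]
      linarith [neg_half_le_sum_cos (φ := Real.pi / 2 - θ) (by linarith) (by linarith) m]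
  simp only [e, Finset.sum_sub_distrib, Finset.sum_const, Finset.card_range, nsmul_eq_mul,
    ← Finset.sum_div]
  linarith

/-- A bound for the expected number of queries of a search that has arrived at the trial with bound
`x` for the number of iterations; `r` is the bound at which trials begin to be successful, and
`K` is the largest one. -/
noncomputable def searchCost (r K x : ℝ) : ℝ := if x < r then 36 * r - 10 * x else 20 * min x K

theorem searchCost_nonneg {r K x : ℝ} (hx : 0 ≤ x) (hK : 0 ≤ K) : 0 ≤ searchCost r K x := by
  unfold searchCost
  split_ifs
  · linarith
  · have := le_min hx hK
    linarith

theorem searchCost_le {r K x : ℝ} (hx : 0 ≤ x) (hK : 0 ≤ K) (hr : r ≤ K) :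
    searchCost r K x ≤ 36 * K := by
  unfold searchCost
  split_ifs
  · linarith
  · linarith [min_le_right x K]

theorem searchCost_one_le {r K : ℝ} (hr : 1 ≤ r) : searchCost r K 1 ≤ 36 * r := by
  unfold searchCost
  split_ifs
  · linarith
  · linarith [min_le_left 1 K]

/-- The constants of `searchCost` balance in all three regimes. Below r, the decrease 10 · x/5 pays
for a trial of cost 2x. When 6x/5 crosses r, the cost 2x + 24x is at most 36r - 10x. Beyond r, 2 +
(3/4) · 20 · (6/5) = 20, which is possible because (3/4)(6/5) < 1. -/
theorem searchCost_step {r K x p m : ℝ} (hx : 0 ≤ x) (hr : 0 ≤ r) (hrK : r ≤ K)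
    (hm : m ≤ 2 * min x K) (h0 : 0 ≤ p) (hp : r ≤ x → 1 / 4 ≤ p) :
    m + (1 - p) * searchCost r K (6 / 5 * x) ≤ searchCost r K x := by
  have hS : 0 ≤ searchCost r K (6 / 5 * x) := searchCost_nonneg (by linarith) (by linarith)
  rcases lt_or_ge x r with hxr | hxr
  · have h1 : (1 - p) * searchCost r K (6 / 5 * x) ≤ searchCost r K (6 / 5 * x) := by nlinarith
    refine (add_le_add hm h1).trans ?_
    have h2 := min_le_left x K
    unfold searchCost
    rw [if_pos hxr]
    split_ifs with h
    · linarith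
    · linarith [min_le_left (6 / 5 * x) K]
  · have hp' := hp hxr
    have h1 : (1 - p) * searchCost r K (6 / 5 * x) ≤ 3 / 4 * searchCost r K (6 / 5 * x) := by
      nlinarith
    refine (add_le_add hm h1).trans ?_
    unfold searchCost
    rw [if_neg (not_lt.2 hxr), if_neg (not_lt.2 (by linarith))]
    have h2 : min (6 / 5 * x) K ≤ 6 / 5 * min x K := by
      rcases min_cases x K with ⟨h, -⟩ | ⟨h, -⟩ <;> rw [h]
      · exact min_le_left _ _
      · exact (min_le_right _ _).trans (by linarith)
    linarith

end Averages

/-! ### Exponential tail of the search -/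

section SearchAnalysis

variable {Q A : Type} [Fintype Q] [Fintype A] [AddCommGroup A]

/-- Here `G` is the mean coefficient after a success and `v` the coefficient of the search that
continues after a failure. The 2j+1 queries multiply the bound by e^(λ(2j+1)) ≤ 1 + 2λ(2j+1); since
the mixture of `G` and `v` is at most 2, this adds at most 4λ(2j+1). If the budget does not suffice,
the exponential with the shifted budget is already at least 1. -/
theorem expect_searchFrom_trial_le [Nonempty Q] {F : Q × A → Prop} {x : Q → A}
    (hM : (solutions F x).Nonempty) {lam θ v G : ℝ} (h0 : 0 ≤ lam)
    (hs : Real.sin θ ^ 2 = (solutions F x).card / Fintype.card Q)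
    {h : Option (Q × A) × ℕ → ℝ} {g : Q → ℝ} {s b : ℕ} (fuel j : ℕ)
    (hG : G = (∑ q ∈ solutions F x, g q) / (solutions F x).card)
    (hnone : ∀ b', h (none, b') ≤ 1)
    (hsome : ∀ q ∈ solutions F x, ∀ b' < b,
      h (some (q, x q), b') ≤ g q * Real.exp (-(lam * b')))
    (hG1 : 1 ≤ G) (hv : G ≤ v) (hv2 : v ≤ 2) (hj : lam * (2 * j + 1) ≤ 1)
    (ih : ∀ b' < b, (searchFrom F fuel (s + 1) b').expect x h ≤ v * Real.exp (-(lam * b'))) :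
    QProg.expect x h (if b < 2 * j + 1 then .ret (none, 0)
      else .block Unit (groverCircuit F j) fun o =>
        open Classical in if F (o.1, o.2.1) then .ret (some (o.1, o.2.1), b - (2 * j + 1))
        else searchFrom F fuel (s + 1) (b - (2 * j + 1)))
      ≤ (G + (1 - Real.sin ((2 * j + 1) * θ) ^ 2) * (v - G) + 4 * (lam * (2 * j + 1)))
        * Real.exp (-(lam * b)) := by
  set p := Real.sin ((2 * (j : ℝ) + 1) * θ) ^ 2 with hp
  have hp0 : 0 ≤ p := sq_nonneg _
  have hp1 : p ≤ 1 := Real.sin_sq_le_one _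
  have hc0 : 0 ≤ lam * (2 * j + 1) := by positivity
  have hw : 1 ≤ p * G + (1 - p) * v := by nlinarith
  have hw2 : p * G + (1 - p) * v ≤ 2 := by nlinarith
  have hexp : Real.exp (lam * (2 * j + 1)) ≤ 1 + 2 * (lam * (2 * j + 1)) := by
    have := Real.abs_exp_sub_one_le (x := lam * (2 * j + 1)) (by rwa [abs_of_nonneg hc0])
    rw [abs_of_nonneg hc0] at this
    linarith [le_abs_self (Real.exp (lam * (2 * j + 1)) - 1)]
  have key : (p * G + (1 - p) * v) * Real.exp (-(lam * (b - (2 * j + 1))))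
      ≤ (G + (1 - p) * (v - G) + 4 * (lam * (2 * j + 1))) * Real.exp (-(lam * b)) := by
    rw [show -(lam * ((b : ℝ) - (2 * j + 1))) = lam * (2 * j + 1) + -(lam * b) by ring,
      Real.exp_add, ← mul_assoc]
    refine mul_le_mul_of_nonneg_right ?_ (Real.exp_pos _).le
    refine (mul_le_mul_of_nonneg_left hexp (by linarith)).trans ?_
    nlinarith
  refine le_trans ?_ key
  split_ifs with hb
  · have hb' : (b : ℝ) ≤ 2 * j + 1 := by exact_mod_cast hb.le
    have : 1 ≤ Real.exp (-(lam * (b - (2 * j + 1)))) := Real.one_le_exp (by nlinarith)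
    refine (hnone 0).trans ?_
    nlinarith
  · push Not at hb
    have hcast : ((b - (2 * j + 1) : ℕ) : ℝ) = b - (2 * j + 1) := by push_cast [hb]; ring
    have hlt : b - (2 * j + 1) < b := by omega
    simp only [QProg.expect]
    refine (sum_groverCircuit_le hM hs j (H := v * Real.exp (-(lam * (b - (2 * j + 1)))))
      fun q hq => ?_).trans ?_
    · rw [if_neg hq, ← hcast]
      exact ih _ hlt
    · rw [← hp, add_mul, mul_assoc, mul_assoc]
      refine add_le_add (mul_le_mul_of_nonneg_left ?_ hp0) le_rfl
      rw [hG, div_mul_eq_mul_div, Finset.sum_mul]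
      refine div_le_div_of_nonneg_right (Finset.sum_le_sum fun q hq => ?_) (Nat.cast_nonneg _)
      rw [if_pos (mem_solutions.1 hq), ← hcast]
      exact hsome q hq _ hlt

/-- Exponential tail of the search algorithm, followed by something that fails with probability at
most `g q * exp (-λ b)` if `q` has been found and `b` queries remain. -/
theorem expect_searchFrom_le [Nonempty Q] {F : Q × A → Prop} {x : Q → A}
    (hM : (solutions F x).Nonempty) {lam G r : ℝ} (h0 : 0 ≤ lam)
    {h : Option (Q × A) × ℕ → ℝ} {g : Q → ℝ} {b₀ : ℕ}
    (hr : r = √(Fintype.card Q / (solutions F x).card))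
    (hG : G = (∑ q ∈ solutions F x, g q) / (solutions F x).card)
    (hnone : ∀ b', h (none, b') ≤ 1)
    (hsome : ∀ q ∈ solutions F x, ∀ b' < b₀,
      h (some (q, x q), b') ≤ g q * Real.exp (-(lam * b')))
    (hG1 : 1 ≤ G) (hG2 : G + 4 * (lam * (36 * √(Fintype.card Q))) ≤ 2) (fuel : ℕ) :
    ∀ s b : ℕ, b ≤ fuel → b ≤ b₀ → (searchFrom F fuel s b).expect x h
      ≤ (G + 4 * (lam * searchCost r √(Fintype.card Q) ((6 / 5) ^ s))) * Real.exp (-(lam * b)) := by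
  have hN : (1 : ℝ) ≤ Fintype.card Q := by exact_mod_cast Fintype.card_pos
  have hM1 : (1 : ℝ) ≤ (solutions F x).card := by exact_mod_cast hM.card_pos
  obtain ⟨θ, hθ0, hθ1, hs⟩ := exists_sin_sq_eq F x
  set K := √(Fintype.card Q : ℝ) with hK
  have hK1 : 1 ≤ K := Real.one_le_sqrt.2 hN
  have hrK : r ≤ K := by
    rw [hr]
    exact Real.sqrt_le_sqrt (div_le_self (by linarith) hM1)
  have hr0 : 0 ≤ r := hr ▸ Real.sqrt_nonneg _
  have hθpos : 0 < θ := by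
    rcases hθ0.eq_or_lt with rfl | h
    · rw [Real.sin_zero] at hs
      have : (0 : ℝ) < (solutions F x).card / Fintype.card Q := by positivity
      simp only [ne_eq, OfNat.ofNat_ne_zero, not_false_eq_true, zero_pow] at hs
      linarith
    · exact h
  have hsin : 0 ≤ Real.sin θ := Real.sin_nonneg_of_nonneg_of_le_pi hθ0 (by linarith [Real.pi_pos])
  -- Thus `r` is exactly the threshold 1/sin θ from which trials succeed with probability 1/4.
  have hrsin : r * Real.sin θ = 1 := by
    rw [hr, ← Real.sqrt_sq hsin, hs, ← Real.sqrt_mul (by positivity)]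
    rw [show (Fintype.card Q : ℝ) / (solutions F x).card
      * ((solutions F x).card / Fintype.card Q) = 1 by field_simp, Real.sqrt_one]
  induction fuel with
  | zero =>
    intro s b hb hb0
    obtain rfl : b = 0 := by omega
    have := searchCost_nonneg (r := r) (K := K) (x := (6 / 5) ^ s) (by positivity) (by linarith)
    simp only [searchFrom, QProg.expect, Nat.cast_zero, mul_zero, neg_zero, Real.exp_zero, mul_one]
    have := hnone 0
    nlinarith [mul_nonneg h0 ‹0 ≤ searchCost r K _›]
  | succ fuel ih =>
    intro s b hb hb0
    rw [searchFrom]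
    set X : ℝ := (6 / 5) ^ s with hX
    have hX1 : 1 ≤ X := one_le_pow₀ (by norm_num)
    -- The integers j with 0 ≤ j < min X K are 0, …, m, so there are m + 1 equally likely choices.
    obtain ⟨m, hm⟩ : ∃ m : ℕ, ⌈min X K⌉₊ = m + 1 :=
      Nat.exists_eq_succ_of_ne_zero (Nat.ceil_pos.2 (lt_min (by linarith) (by linarith))).ne'
    have hmlt : (m : ℝ) < min X K := by
      have := Nat.ceil_lt_add_one (a := min X K) (le_min (by linarith) (by linarith))
      rw [hm] at this
      push_cast at this
      linarith
    have hmge : min X K ≤ m + 1 := by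
      have := Nat.le_ceil (min X K)
      rw [hm] at this
      exact_mod_cast this
    rw [← hK, hm, Nat.add_sub_cancel]
    simp only [QProg.expect]
    set v := G + 4 * (lam * searchCost r K ((6 / 5) ^ (s + 1))) with hv
    have hS0 := searchCost_nonneg (r := r) (K := K) (x := (6 / 5) ^ (s + 1)) (by positivity)
      (by linarith)
    have hS1 := searchCost_le (r := r) (K := K) (x := (6 / 5) ^ (s + 1)) (by positivity)
      (by linarith) hrK
    have hlS0 := mul_nonneg h0 hS0
    have hlS1 := mul_le_mul_of_nonneg_left hS1 h0
    -- Since 4 · 36 = 144, this follows from `hG1` and `hG2`. It makes λ(2j+1) ≤ 3λK ≤ 1 in every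
    -- trial.
    have hlK : lam * K ≤ 1 / 144 := by linarith
    have hbound : ∀ j : Fin (m + 1), _ := fun j =>
      expect_searchFrom_trial_le (s := s) (b := b) (v := v) hM h0 hs fuel j hG hnone
        (fun q hq b' hb' => hsome q hq b' (by omega)) hG1 (by linarith) (by linarith) (by
          have hj : ((j : ℕ) : ℝ) ≤ m := by exact_mod_cast Nat.lt_succ_iff.1 j.2
          have : lam * (2 * ((j : ℕ) : ℝ) + 1) ≤ lam * (3 * K) := by
            refine mul_le_mul_of_nonneg_left ?_ h0
            linarith [min_le_right X K]
          linarith)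
        fun b' hb' => ih (s + 1) b' (by omega) (by omega)
    refine (div_le_div_of_nonneg_right (Finset.sum_le_sum fun j _ => hbound j)
      (by positivity)).trans ?_
    rw [← Finset.sum_mul, mul_div_right_comm]
    refine mul_le_mul_of_nonneg_right ?_ (Real.exp_pos _).le
    set p : ℝ := (∑ j ∈ Finset.range (m + 1), Real.sin ((2 * j + 1) * θ) ^ 2) / (m + 1) with hp
    have hp0 : 0 ≤ p := div_nonneg (Finset.sum_nonneg fun _ _ => sq_nonneg _) (by positivity)
    have hp4 : r ≤ X → 1 / 4 ≤ p := by
      intro hrX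
      rw [hp, le_div_iff₀ (by positivity)]
      have := quarter_le_sum_sin_sq (m := m + 1) hθpos hθ1 (by
        rw [← hrsin]
        refine mul_le_mul_of_nonneg_right ?_ hsin
        push_cast
        exact (le_min hrX hrK).trans hmge)
      push_cast at this
      linarith
    have hstep := searchCost_step (m := m + 1) (by linarith) hr0 hrK
      (by linarith [le_min hX1 hK1]) hp0 hp4
    -- The mean of 2j+1 over the m+1 choices is m+1, the cost charged in `hstep`.
    have hodd : ∑ j ∈ Finset.range (m + 1), (2 * (j : ℝ) + 1) = (m + 1) ^ 2 := by
      clear_value X p v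
      clear * -
      induction m with
      | zero => simp
      | succ m ih => rw [Finset.sum_range_succ, ih]; push_cast; ring
    have hsum : (∑ j : Fin (m + 1), (G + (1 - Real.sin ((2 * ((j : ℕ) : ℝ) + 1) * θ) ^ 2) * (v - G)
        + 4 * (lam * (2 * ((j : ℕ) : ℝ) + 1)))) / (m + 1)
        = G + (1 - p) * (v - G) + 4 * (lam * (m + 1)) := by
      rw [Fin.sum_univ_eq_sum_range (fun j : ℕ => G + (1 - Real.sin ((2 * (j : ℝ) + 1) * θ) ^ 2)
        * (v - G) + 4 * (lam * (2 * (j : ℝ) + 1))) (m + 1)]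
      rw [Finset.sum_add_distrib, Finset.sum_add_distrib, ← Finset.mul_sum, ← Finset.mul_sum, hodd,
        ← Finset.sum_mul, Finset.sum_sub_distrib]
      simp only [Finset.sum_const, Finset.card_range, nsmul_eq_mul, mul_one]
      rw [hp]
      push_cast
      generalize ∑ j ∈ Finset.range (m + 1), Real.sin ((2 * (j : ℝ) + 1) * θ) ^ 2 = T
      field_simp
    rw [hsum]
    rw [← hX, show (6 / 5 : ℝ) * X = (6 / 5) ^ (s + 1) by rw [hX, pow_succ, mul_comm]] at *
    have := mul_le_mul_of_nonneg_left hstep h0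
    rw [hv]
    nlinarith

end SearchAnalysis

/-! ### The potential function and the mean progress of an improvement -/

section Potential

/-- The bound for the expected number of queries, in units of `72 √N`, that are needed when there
are `M` good items of at most `τ` types. -/
noncomputable def potential (τ : ℝ) (M : ℕ) : ℝ :=
  ∑ i ∈ Finset.range M, τ / (√((i : ℝ) + 1) * ((i : ℝ) + 1 + τ))

theorem potential_nonneg {τ : ℝ} (h : 0 ≤ τ) (M : ℕ) : 0 ≤ potential τ M :=
  Finset.sum_nonneg fun _ _ => by positivity

/-- The sum is comparable to ∫ τ/(√y (y+τ)) dy = π√τ over the half-line. The induction uses the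
majorant 4√τ · √M/(√M+√τ), whose increments dominate the summands. -/
theorem potential_le {τ : ℝ} (h : 0 < τ) (M : ℕ) : potential τ M ≤ 4 * √τ := by
  have hT : 0 < √τ := Real.sqrt_pos.2 h
  have key : potential τ M ≤ 4 * √τ * (√(M : ℝ) / (√(M : ℝ) + √τ)) := by
    induction M with
    | zero => simp [potential]
    | succ M ih =>
      rw [potential, Finset.sum_range_succ, ← potential]
      refine (add_le_add ih le_rfl).trans ?_
      have hA : 0 ≤ √(M : ℝ) := Real.sqrt_nonneg _
      have hB : 0 < √((M : ℝ) + 1) := Real.sqrt_pos.2 (by positivity)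
      have hA2 : √(M : ℝ) ^ 2 = M := Real.sq_sqrt (by positivity)
      have hB2 : √((M : ℝ) + 1) ^ 2 = M + 1 := Real.sq_sqrt (by positivity)
      have hT2 : √τ ^ 2 = τ := Real.sq_sqrt h.le
      push_cast
      generalize √(M : ℝ) = a at *
      generalize √((M : ℝ) + 1) = b at *
      generalize √τ = t at *
      rw [← hB2, ← hT2]
      have hab : b ^ 2 = a ^ 2 + 1 := by rw [hB2, hA2]
      have hle : a ≤ b := by nlinarith
      have h1 : 1 ≤ 2 * b * (b - a) := by nlinarith
      have h2 : (a + t) * (b + t) ≤ 4 * (b - a) * b * (b ^ 2 + t ^ 2) := by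
        have e1 : (a + t) * (b + t) ≤ (b + t) * (b + t) := by gcongr
        have e2 : (b + t) * (b + t) ≤ 2 * (b ^ 2 + t ^ 2) := by nlinarith [sq_nonneg (b - t)]
        have e3 : 2 * (b ^ 2 + t ^ 2) ≤ 2 * (2 * b * (b - a)) * (b ^ 2 + t ^ 2) := by
          nlinarith [sq_nonneg b, sq_nonneg t]
        linarith
      have h3 : t ^ 2 / (b * (b ^ 2 + t ^ 2)) ≤ 4 * t * (t * (b - a)) / ((a + t) * (b + t)) := by
        rw [div_le_div_iff₀ (by positivity) (by positivity)]
        nlinarith [sq_nonneg t]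
      have h4 : 4 * t * (b / (b + t)) = 4 * t * (a / (a + t))
          + 4 * t * (t * (b - a)) / ((a + t) * (b + t)) := by
        field_simp
        ring
      rw [h4]
      linarith
  refine key.trans (mul_le_of_le_one_right (by positivity) ?_)
  rw [div_le_one (by positivity)]
  linarith

/-- The summands decrease, so each of the M - M' removed ones is at least the last. -/
theorem mul_le_potential_sub {τ : ℝ} (h : 0 < τ) {M' M : ℕ} (hM : M' ≤ M) :
    ((M : ℝ) - M') * (τ / (√(M : ℝ) * (M + τ))) ≤ potential τ M - potential τ M' := by
  rw [potential, potential, ← Finset.sum_Ico_eq_sub _ hM]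
  have : ∀ i ∈ Finset.Ico M' M, τ / (√(M : ℝ) * (M + τ))
      ≤ τ / (√((i : ℝ) + 1) * ((i : ℝ) + 1 + τ)) := by
    intro i hi
    have hi' : ((i : ℝ) + 1) ≤ M := by exact_mod_cast (Finset.mem_Ico.1 hi).2
    gcongr
  have h2 := Finset.card_nsmul_le_sum _ _ _ this
  rw [Nat.card_Ico, nsmul_eq_mul, Nat.cast_sub hM] at h2
  exact h2

open Classical in
/-- Comparing every element with all elements of its type: on average, an element is exceeded
(weakly) by half the elements of its type. -/
theorem card_mul_add_le_sum_card {ι T α : Type*} [LinearOrder α] (s : Finset ι) (g : ι → T)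
    (f : ι → α) {τ : ℝ} (h : ((s.image g).card : ℝ) ≤ τ) :
    (s.card : ℝ) * (s.card + τ)
      ≤ 2 * τ * ∑ q ∈ s, ((s.filter fun q' => g q' = g q ∧ f q ≤ f q').card : ℝ) := by
  have hτ : 0 ≤ τ := le_trans (Nat.cast_nonneg _) h
  set D : ι → ℕ := fun q => (s.filter fun q' => g q' = g q ∧ f q ≤ f q').card with hD
  set D' : ι → ℕ := fun q => (s.filter fun q' => g q' = g q ∧ f q' ≤ f q).card with hD'
  have hswap : ∑ q ∈ s, D q = ∑ q ∈ s, D' q := by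
    have := Finset.sum_card_bipartiteAbove_eq_sum_card_bipartiteBelow (s := s) (t := s)
      (fun q q' => g q' = g q ∧ f q ≤ f q')
    rw [hD, hD']
    simp only [Finset.bipartiteAbove, Finset.bipartiteBelow] at this
    rw [this]
    refine Finset.sum_congr rfl fun q _ => ?_
    congr 1
    exact Finset.filter_congr fun q' _ => by rw [eq_comm]
  -- The items weakly above and weakly below `q` cover its type and both include `q` itself, hence
  -- the +1.
  have hadd : ∀ q ∈ s, (s.filter fun q' => g q' = g q).card + 1 ≤ D q + D' q := by
    intro q hq
    have hu : (s.filter fun q' => g q' = g q)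
        ⊆ (s.filter fun q' => g q' = g q ∧ f q ≤ f q')
          ∪ (s.filter fun q' => g q' = g q ∧ f q' ≤ f q) := by
      intro q' hq'
      simp only [Finset.mem_union, Finset.mem_filter] at hq' ⊢
      rcases le_total (f q) (f q') with h | h
      · exact Or.inl ⟨hq'.1, hq'.2, h⟩
      · exact Or.inr ⟨hq'.1, hq'.2, h⟩
    have hi : 1 ≤ ((s.filter fun q' => g q' = g q ∧ f q ≤ f q')
          ∩ (s.filter fun q' => g q' = g q ∧ f q' ≤ f q)).card :=
      Finset.card_pos.2 ⟨q, by simp [hq]⟩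
    have := Finset.card_union_add_card_inter (s.filter fun q' => g q' = g q ∧ f q ≤ f q')
      (s.filter fun q' => g q' = g q ∧ f q' ≤ f q)
    have := Finset.card_le_card hu
    simp only [hD, hD']
    omega
  have hsq : ∑ q ∈ s, (s.filter fun q' => g q' = g q).card
      = ∑ c ∈ s.image g, (s.filter fun q' => g q' = c).card ^ 2 := by
    rw [← Finset.sum_fiberwise_of_maps_to (fun q hq => Finset.mem_image_of_mem g hq)]
    refine Finset.sum_congr rfl fun c _ => ?_
    rw [Finset.sum_congr rfl (g := fun _ => (s.filter fun q' => g q' = c).card) fun q hq => by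
      rw [(Finset.mem_filter.1 hq).2]]
    rw [Finset.sum_const, smul_eq_mul, sq]
  -- Cauchy–Schwarz over the types: the sum counts ordered pairs of equal type, which is the sum of
  -- the squared type sizes.
  have hcs : s.card ^ 2 ≤ (s.image g).card * ∑ q ∈ s, (s.filter fun q' => g q' = g q).card := by
    rw [hsq]
    refine le_trans (le_of_eq ?_) sq_sum_le_card_mul_sum_sq
    rw [Finset.card_eq_sum_card_fiberwise (f := g) (t := s.image g)
      fun q hq => Finset.mem_coe.2 (Finset.mem_image_of_mem g hq)]
  have hle : ∑ q ∈ s, (s.filter fun q' => g q' = g q).card + s.card ≤ 2 * ∑ q ∈ s, D q := by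
    have := Finset.sum_le_sum hadd
    rw [Finset.sum_add_distrib, Finset.sum_add_distrib, ← hswap, Finset.sum_const, smul_eq_mul,
      mul_one] at this
    omega
  have hcs' : (s.card : ℝ) ^ 2
      ≤ τ * (∑ q ∈ s, (s.filter fun q' => g q' = g q).card : ℕ) := by
    refine le_trans ?_ (mul_le_mul_of_nonneg_right h (Nat.cast_nonneg _))
    exact_mod_cast hcs
  have hle' : ((∑ q ∈ s, (s.filter fun q' => g q' = g q).card : ℕ) : ℝ) + s.card
      ≤ 2 * ∑ q ∈ s, (D q : ℝ) := by exact_mod_cast hle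
  have := mul_le_mul_of_nonneg_left hle' hτ
  linarith

end Potential

/-! ### Exponential tail of the greedy loop -/

section Selections

variable {Q A T : Type} [Fintype Q] [Fintype A] [AddCommGroup A]

/-- A set of genuine items of finite value and different types. -/
structure IsSelection (x : Q → A) (f : Q × A → ℕ∞) (g : Q × A → T) (I : Finset (Q × A)) :
    Prop where
  genuine : ∀ i ∈ I, i.2 = x i.1
  finite : ∀ i ∈ I, f i < ⊤
  inj : ∀ i ∈ I, ∀ i' ∈ I, g i = g i' → i = i'

variable {x : Q → A} {f : Q × A → ℕ∞} {g : Q × A → T} {d : ℕ} {I : Finset (Q × A)}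

theorem IsSelection.card_lt [Finite T] (hI : IsSelection x f g I) (hd : Nat.card T ≤ d)
    {o : Q × A} (ho : ∀ i ∈ I, g i ≠ g o) : I.card < d := by
  classical
  have := Fintype.ofFinite T
  rw [Nat.card_eq_fintype_card] at hd
  rw [← Finset.card_image_of_injOn (f := g) (s := I) fun i hi i' hi' => hI.inj i hi i' hi']
  refine lt_of_lt_of_le (Finset.card_lt_univ_of_notMem (x := g o) fun h => ?_) hd
  obtain ⟨i, hi, h⟩ := Finset.mem_image.1 h
  exact ho i hi h

/-- With sufficiently many artificial items, nothing is ever thrown out for lack of space. -/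
theorem IsSelection.isGood_iff [Finite T] (hI : IsSelection x f g I) (hd : Nat.card T ≤ d)
    {o : Q × A} : IsGood f g d I o ↔ f o < ⊤ ∧ ∀ i ∈ I, g i = g o → f o < f i := by
  constructor
  · rintro (⟨i, hi, h1, h2⟩ | ⟨h1, h2⟩)
    · refine ⟨lt_of_lt_of_le h2 le_top, fun i' hi' h => ?_⟩
      rwa [hI.inj i' hi' i hi (h.trans h1.symm)]
    · refine ⟨?_, fun i hi h => absurd h (h1 i hi)⟩
      rcases h2 with ⟨-, h2⟩ | ⟨i, -, h2⟩
      · exact h2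
      · exact lt_of_lt_of_le h2 le_top
  · rintro ⟨h1, h2⟩
    by_cases h : ∃ i ∈ I, g i = g o
    · obtain ⟨i, hi, h⟩ := h
      exact Or.inl ⟨i, hi, h, h2 i hi h⟩
    · push Not at h
      exact Or.inr ⟨h, Or.inl ⟨hI.card_lt hd h, h1⟩⟩

open Classical in
theorem IsSelection.improve_eq [Finite T] (hI : IsSelection x f g I) (hd : Nat.card T ≤ d)
    (o : Q × A) : improve f g d I o = insert o (I.filter fun i => g i ≠ g o) := by
  unfold improve
  split_ifs with h1 h2 h3
  · rfl
  · push Not at h1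
    rw [Finset.filter_true_of_mem h1]
  · push Not at h1
    exact absurd (hI.card_lt hd h1) h2
  · push Not at h1
    exact absurd (hI.card_lt hd h1) h2

theorem IsSelection.improve [Finite T] (hI : IsSelection x f g I) (hd : Nat.card T ≤ d)
    {o : Q × A} (ho : o.2 = x o.1) (hf : f o < ⊤) : IsSelection x f g (improve f g d I o) := by
  classical
  rw [hI.improve_eq hd]
  refine ⟨fun i hi => ?_, fun i hi => ?_, fun i hi i' hi' h => ?_⟩
  · rcases Finset.mem_insert.1 hi with rfl | hi
    · exact ho
    · exact hI.genuine i (Finset.mem_filter.1 hi).1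
  · rcases Finset.mem_insert.1 hi with rfl | hi
    · exact hf
    · exact hI.finite i (Finset.mem_filter.1 hi).1
  · rcases Finset.mem_insert.1 hi with rfl | hi <;> rcases Finset.mem_insert.1 hi' with rfl | hi'
    · rfl
    · exact absurd h.symm (Finset.mem_filter.1 hi').2
    · exact absurd h (Finset.mem_filter.1 hi).2
    · exact hI.inj i (Finset.mem_filter.1 hi).1 i' (Finset.mem_filter.1 hi').1 h

-- The new item displaces any competitor of its type, whose value was larger. Other types are
-- unaffected; within its type, exactly the items of at least the new value stop being good, `q`
-- among them.
open Classical in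
theorem IsSelection.solutions_improve [Finite T] (hI : IsSelection x f g I)
    (hd : Nat.card T ≤ d) {q : Q} (hq : q ∈ solutions (IsGood f g d I) x) :
    solutions (IsGood f g d (_root_.improve f g d I (q, x q))) x
      = (solutions (IsGood f g d I) x).filter fun q' =>
        ¬ (g (q', x q') = g (q, x q) ∧ f (q, x q) ≤ f (q', x q')) := by
  have hq1 := (hI.isGood_iff hd).1 (mem_solutions.1 hq)
  have hI' := hI.improve hd (o := (q, x q)) rfl hq1.1
  ext q'
  rw [Finset.mem_filter, mem_solutions, mem_solutions, hI'.isGood_iff hd, hI.isGood_iff hd,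
    hI.improve_eq hd]
  constructor
  · rintro ⟨h1, h2⟩
    refine ⟨⟨h1, fun i hi h => ?_⟩, fun h => ?_⟩
    · by_cases h3 : g i = g (q, x q)
      · exact (h2 _ (Finset.mem_insert_self _ _) (h3.symm.trans h)).trans (hq1.2 i hi h3)
      · exact h2 i (Finset.mem_insert_of_mem (Finset.mem_filter.2 ⟨hi, h3⟩)) h
    · exact absurd (h2 _ (Finset.mem_insert_self _ _) h.1.symm) (not_lt.2 h.2)
  · rintro ⟨⟨h1, h2⟩, h3⟩
    refine ⟨h1, fun i hi h => ?_⟩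
    rcases Finset.mem_insert.1 hi with rfl | hi
    · by_contra h4
      exact h3 ⟨h.symm, not_lt.1 h4⟩
    · exact h2 i (Finset.mem_filter.1 hi).1 h

/-- The average potential after a random improvement. -/
theorem IsSelection.sum_potential_le [Finite T] (hI : IsSelection x f g I)
    (hd : Nat.card T ≤ d) {τ : ℝ} (hτ : 0 < τ)
    (ht : (((Set.range fun q : Q => (q, x q)) ∩ {o | f o < ⊤}).image g).ncard ≤ τ) :
    ∑ q ∈ solutions (IsGood f g d I) x,
        potential τ (solutions (IsGood f g d (_root_.improve f g d I (q, x q))) x).card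
      + √((solutions (IsGood f g d I) x).card : ℝ) / 2
      ≤ (solutions (IsGood f g d I) x).card * potential τ (solutions (IsGood f g d I) x).card := by
  classical
  set s := solutions (IsGood f g d I) x with hs
  rcases s.eq_empty_or_nonempty with h0 | h0
  · simp [h0]
  have hM : (0 : ℝ) < s.card := by exact_mod_cast h0.card_pos
  set D : Q → Finset Q := fun q => s.filter fun q' =>
    g (q', x q') = g (q, x q) ∧ f (q, x q) ≤ f (q', x q') with hD
  have hcard : ∀ q ∈ s, ((solutions (IsGood f g d (_root_.improve f g d I (q, x q))) x).card : ℝ)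
      = s.card - (D q).card := by
    intro q hq
    rw [hI.solutions_improve hd hq, eq_sub_iff_add_eq, add_comm]
    exact_mod_cast Finset.card_filter_add_card_filter_not _
  have hτ' : ((s.image fun q => g (q, x q)).card : ℝ) ≤ τ := by
    refine le_trans ?_ ht
    rw [← Set.ncard_coe_finset]
    refine Nat.cast_le.2 (Set.ncard_le_ncard ?_ (((Set.finite_range fun q : Q => (q, x q)).inter_of_left _).image _))
    intro c hc
    obtain ⟨q, hq, rfl⟩ := Finset.mem_image.1 (Finset.mem_coe.1 hc)
    exact ⟨(q, x q), ⟨⟨q, rfl⟩, ((hI.isGood_iff hd).1 (mem_solutions.1 hq)).1⟩, rfl⟩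
  have hpairs := card_mul_add_le_sum_card s (fun q => g (q, x q)) (fun q => f (q, x q)) hτ'
  have hstep : ∀ q ∈ s, potential τ
      (solutions (IsGood f g d (_root_.improve f g d I (q, x q))) x).card
      ≤ potential τ s.card - (D q).card * (τ / (√(s.card : ℝ) * (s.card + τ))) := by
    intro q hq
    have hle : (solutions (IsGood f g d (_root_.improve f g d I (q, x q))) x).card ≤ s.card := by
      rw [hI.solutions_improve hd hq]
      exact Finset.card_filter_le _ _
    have := mul_le_potential_sub hτ hle
    rw [hcard q hq] at this
    linarith
  have hsum := Finset.sum_le_sum hstep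
  rw [Finset.sum_sub_distrib, Finset.sum_const, nsmul_eq_mul, ← Finset.sum_mul] at hsum
  have hsq : 0 < √(s.card : ℝ) := Real.sqrt_pos.2 hM
  -- The mean number eliminated, (M+τ)/(2τ), times the last increment τ/(√M(M+τ)) is 1/(2√M); here
  -- this is multiplied by M. The potential is designed for this cancellation.
  have hlow : √(s.card : ℝ) / 2
      ≤ (∑ q ∈ s, ((D q).card : ℝ)) * (τ / (√(s.card : ℝ) * (s.card + τ))) := by
    rw [mul_div_assoc', le_div_iff₀ (by positivity)]
    have := Real.mul_self_sqrt hM.le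
    calc √(s.card : ℝ) / 2 * (√(s.card : ℝ) * (s.card + τ))
        = (√(s.card : ℝ) * √(s.card : ℝ)) * (s.card + τ) / 2 := by ring
      _ ≤ _ := by rw [this]; linarith
  linarith

/-- A measured pair is always some `(q, x q)`, so there are no false positives and the search can
only end with `none`. -/
theorem expect_searchFrom_le_of_solutions_eq_empty [Nonempty Q] {F : Q × A → Prop}
    (hM : solutions F x = ∅) {h : Option (Q × A) × ℕ → ℝ} {a : ℝ} (hnone : ∀ b, h (none, b) ≤ a)
    (fuel : ℕ) : ∀ s b : ℕ, (searchFrom F fuel s b).expect x h ≤ a := by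
  induction fuel with
  | zero => exact fun s b => hnone 0
  | succ fuel ih =>
    intro s b
    rw [searchFrom, QProg.expect, div_le_iff₀ (by positivity)]
    refine (Finset.sum_le_card_nsmul _ _ a fun j _ => ?_).trans (le_of_eq ?_)
    · split_ifs with hb
      · exact hnone 0
      · rw [QProg.expect, sum_groverCircuit_eq]
        have h1 := QProg.sum_norm_sq_finalState (groverCircuit F j) x
        have h2 := sum_groverCircuit_eq F x j fun _ => 1
        simp only [mul_one] at h2
        rw [h1] at h2
        rw [← one_mul a, h2, Finset.sum_mul]
        refine Finset.sum_le_sum fun q _ => mul_le_mul_of_nonneg_left ?_ (sq_nonneg _)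
        rw [if_neg fun hq => by simpa [hM] using mem_solutions.2 hq]
        exact ih _ _
    · rw [Finset.card_univ, Fintype.card_fin, nsmul_eq_mul, mul_comm]
      push_cast
      rfl

/-- The selection is optimal: for every type it contains an item of least value. -/
def IsOptimal (x : Q → A) (f : Q × A → ℕ∞) (g : Q × A → T) (I : Finset (Q × A)) : Prop :=
  IsSelection x f g I ∧ ∀ q, f (q, x q) < ⊤ → ∃ i ∈ I, g i = g (q, x q) ∧ f i ≤ f (q, x q)

theorem IsSelection.isOptimal [Finite T] (hI : IsSelection x f g I)
    (hd : Nat.card T ≤ d) (h0 : solutions (IsGood f g d I) x = ∅) : IsOptimal x f g I := by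
  refine ⟨hI, fun q hq => ?_⟩
  by_contra! h
  have := mem_solutions.2 ((hI.isGood_iff hd (o := (q, x q))).2 ⟨hq, fun i hi hg => h i hi hg⟩)
  simp [h0] at this

theorem IsSelection.expect_dSmallestFrom_eq_zero [Finite T] (hI : IsSelection x f g I)
    (hd : Nat.card T ≤ d) (h0 : solutions (IsGood f g d I) x = ∅) (fuel b : ℕ) :
    (dSmallestFrom f g d fuel I b).expect x ({I | IsOptimal x f g I}ᶜ.indicator 1) ≤ 0 := by
  have hopt : ({I | IsOptimal x f g I}ᶜ.indicator 1 I : ℝ) ≤ 0 := by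
    rw [Set.indicator_of_notMem]
    exact fun h => h (hI.isOptimal hd h0)
  cases fuel with
  | zero => exact hopt
  | succ fuel =>
    rw [dSmallestFrom, QProg.expect_bind, search]
    split_ifs with hQ
    · exact expect_searchFrom_le_of_solutions_eq_empty h0 (fun b => hopt) _ _ _
    · exact hopt

/-- A search adds at most 4 · 36 λ√(N/M) to the coefficient, and the mean drop 1/(2√M) of the
potential compensates it because 288 = 2 · 4 · 36. In `hl`, 1296 = 288 · 4 + 4 · 36 accounts for the
largest potential and the costliest single search, which keeps the coefficient at most 2. -/
theorem IsSelection.expect_dSmallestFrom_le [Finite T]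
    (hd : Nat.card T ≤ d) {τ lam : ℝ} (hτ : 1 ≤ τ) (hlam : 0 ≤ lam)
    (hl : 1296 * (lam * (√(Fintype.card Q) * √τ)) ≤ 1)
    (ht : (((Set.range fun q : Q => (q, x q)) ∩ {o | f o < ⊤}).image g).ncard ≤ τ) (fuel : ℕ) :
    ∀ (b : ℕ) (I : Finset (Q × A)), IsSelection x f g I → b ≤ fuel →
    (dSmallestFrom f g d fuel I b).expect x ({I | IsOptimal x f g I}ᶜ.indicator 1)
      ≤ (1 + 288 * (lam * (√(Fintype.card Q) *
        potential τ (solutions (IsGood f g d I) x).card))) * Real.exp (-(lam * b)) := by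
  have hone : ∀ I : Finset (Q × A), ({I | IsOptimal x f g I}ᶜ.indicator 1 I : ℝ) ≤ 1 := fun I =>
    Set.indicator_le_self' (fun _ _ => zero_le_one) I
  have hone' : ∀ p : QProg Q A (Finset (Q × A)),
      p.expect x ({I | IsOptimal x f g I}ᶜ.indicator 1) ≤ 1 := QProg.expect_le_of_le hone
  have hpos : ∀ M, 0 ≤ lam * (√(Fintype.card Q : ℝ) * potential τ M) := fun M =>
    mul_nonneg hlam (mul_nonneg (Real.sqrt_nonneg _) (potential_nonneg (by linarith) M))
  induction fuel with
  | zero =>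
    intro b I hI hb
    obtain rfl : b = 0 := by omega
    refine (hone' _).trans ?_
    simp only [Nat.cast_zero, mul_zero, neg_zero, Real.exp_zero, mul_one]
    linarith [hpos (solutions (IsGood f g d I) x).card]
  | succ fuel ih =>
    intro b I hI hb
    set s := solutions (IsGood f g d I) x with hs
    rcases s.eq_empty_or_nonempty with h0 | h0
    · refine (hI.expect_dSmallestFrom_eq_zero hd h0 _ _).trans ?_
      exact mul_nonneg (by linarith [hpos s.card]) (Real.exp_pos _).le
    have hQ : Nonempty Q := ⟨h0.choose⟩
    rw [dSmallestFrom, QProg.expect_bind, search, dif_pos hQ]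
    set K := √(Fintype.card Q : ℝ) with hK
    have hN : (0 : ℝ) < Fintype.card Q := by exact_mod_cast Fintype.card_pos
    have hK0 : 0 < K := Real.sqrt_pos.2 hN
    have hM : (0 : ℝ) < s.card := by exact_mod_cast h0.card_pos
    set Φ : Q → ℝ := fun q =>
      potential τ (solutions (IsGood f g d (_root_.improve f g d I (q, x q))) x).card with hΦ
    set G := (∑ q ∈ s, (1 + 288 * (lam * (K * Φ q)))) / s.card with hG
    have hpot := hI.sum_potential_le hd (by linarith) ht
    rw [← hs] at hpot
    change ∑ q ∈ s, Φ q + _ ≤ _ at hpot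
    have hGeq : G = 1 + 288 * (lam * (K * ((∑ q ∈ s, Φ q) / s.card))) := by
      rw [hG, Finset.sum_add_distrib, ← Finset.mul_sum, ← Finset.mul_sum, ← Finset.mul_sum]
      simp only [Finset.sum_const, nsmul_eq_mul, mul_one]
      field_simp
    have hΦ0 : 0 ≤ (∑ q ∈ s, Φ q) / s.card :=
      div_nonneg (Finset.sum_nonneg fun q _ => potential_nonneg (by linarith) _) hM.le
    have hΦ1 : (∑ q ∈ s, Φ q) / s.card ≤ 4 * √τ := by
      rw [div_le_iff₀ hM, mul_comm, ← nsmul_eq_mul]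
      exact Finset.sum_le_card_nsmul _ _ _ fun q _ => potential_le (by linarith) _
    have hτ1 : 1 ≤ √τ := Real.one_le_sqrt.2 hτ
    have h5 : 0 ≤ lam * K := mul_nonneg hlam hK0.le
    -- A successful search consumes at least one query; the strict inequality `b' < b` is what lets
    -- the induction hypothesis with one unit of fuel less apply.
    have hbound := expect_searchFrom_le (lam := lam) (G := G) (g := fun q =>
        1 + 288 * (lam * (K * Φ q))) (b₀ := b) h0 hlam rfl hG (h := fun r =>
        QProg.expect x ({I | IsOptimal x f g I}ᶜ.indicator 1) (match r with
          | (none, _) => .ret I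
          | (some o, budget') => dSmallestFrom f g d fuel (_root_.improve f g d I o) budget'))
      (fun b' => hone' _) (fun q hq b' hb' => ih b' _
        (hI.improve hd rfl ((hI.isGood_iff hd).1 (mem_solutions.1 hq)).1) (by omega))
      (by rw [hGeq]; have := mul_nonneg h5 hΦ0; nlinarith)
      (by
        rw [hGeq, ← hK]
        have h6 := mul_le_mul_of_nonneg_left hΦ1 h5
        have h7 := mul_le_mul_of_nonneg_left hτ1 h5
        nlinarith) b 0 b le_rfl le_rfl
    refine hbound.trans (mul_le_mul_of_nonneg_right ?_ (Real.exp_pos _).le)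
    rw [pow_zero, ← hK, ← hs]
    have hr : 1 ≤ √(Fintype.card Q / (s.card : ℝ)) := by
      rw [Real.one_le_sqrt, one_le_div hM]
      exact_mod_cast Finset.card_le_univ _
    have hS := mul_le_mul_of_nonneg_left (searchCost_one_le (K := K) hr) hlam
    have hsq : √(Fintype.card Q / (s.card : ℝ)) = K * (√(s.card : ℝ) / s.card) := by
      rw [Real.sqrt_div hN.le, Real.sqrt_div_self', mul_one_div]
    rw [hsq] at hS
    have hdiv : (∑ q ∈ s, Φ q) / s.card + (√(s.card : ℝ) / s.card) / 2 ≤ potential τ s.card := by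
      rw [div_right_comm, ← add_div, div_le_iff₀ hM]
      linarith
    have := mul_le_mul_of_nonneg_left hdiv h5
    rw [hGeq, hsq]
    linarith

/-- The `d` smallest values of different type are found except with exponentially small
probability, where `τ` bounds the number of types with a finite value. -/
theorem expect_dSmallest_le [Finite T] (hd : Nat.card T ≤ d) {τ : ℝ} (hτ : 1 ≤ τ)
    (hQ : Nonempty Q)
    (ht : (((Set.range fun q : Q => (q, x q)) ∩ {o | f o < ⊤}).image g).ncard ≤ τ) (b : ℕ) :
    (dSmallest f g d b).expect x ({I | IsOptimal x f g I}ᶜ.indicator 1)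
      ≤ 2 * Real.exp (-(b / (1296 * √(τ * Fintype.card Q)))) := by
  have hN : (0 : ℝ) < Fintype.card Q := by exact_mod_cast Fintype.card_pos
  have hK0 : 0 < √(Fintype.card Q : ℝ) := Real.sqrt_pos.2 hN
  have hτ0 : 0 < √τ := Real.sqrt_pos.2 (by linarith)
  -- The largest rate that `hl` admits; the coefficient is then at most 1 + 288 · 4/1296 ≤ 2.
  set lam : ℝ := 1 / (1296 * √(τ * Fintype.card Q)) with hlam
  have hlam' : lam * (√(Fintype.card Q : ℝ) * √τ) = 1 / 1296 := by
    rw [hlam, Real.sqrt_mul (by linarith)]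
    field_simp
  have h0 : 0 ≤ lam := by positivity
  have hI : IsSelection x f g ∅ := ⟨by simp, by simp, by simp⟩
  refine (IsSelection.expect_dSmallestFrom_le hd hτ h0 (by linarith) ht b b ∅ hI le_rfl).trans ?_
  rw [show -((b : ℝ) / (1296 * √(τ * Fintype.card Q))) = -(lam * b) by rw [hlam]; ring]
  refine mul_le_mul_of_nonneg_right ?_ (Real.exp_pos _).le
  have := mul_le_mul_of_nonneg_left (potential_le (τ := τ) (by linarith)
    (solutions (IsGood f g d ∅) x).card) (mul_nonneg h0 hK0.le)
  linarith

end Selections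

/-! ### Deterministic query bounds -/

section QueryBounds

variable {Q A T : Type} [Fintype Q] [Fintype A] [AddCommGroup A] {x : Q → A}

theorem length_gates_groverCircuit [Nonempty Q] (F : Q × A → Prop) (j : ℕ) :
    (groverCircuit F j).gates.length = 2 * j + 1 := by
  simp [groverCircuit, mul_comm]

/-- Bounding queries made plus budget returned, rather than queries alone, lets successive searches
share one budget. -/
theorem queries_searchFrom [Nonempty Q] (F : Q × A → Prop) (fuel : ℕ) :
    ∀ s b : ℕ, ∀ o ∈ ((searchFrom F fuel s b).run x).support, o.2 + o.1.2 ≤ b := by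
  induction fuel with
  | zero =>
    intro s b o ho
    rw [searchFrom, QProg.mem_support_run_ret] at ho
    simp [ho]
  | succ fuel ih =>
    intro s b o ho
    rw [searchFrom, QProg.mem_support_run_rand] at ho
    obtain ⟨j, hj⟩ := ho
    split_ifs at hj with hb
    · rw [QProg.mem_support_run_ret] at hj
      simp [hj]
    · obtain ⟨c, o', ho', rfl⟩ := QProg.mem_support_run_block hj
      rw [length_gates_groverCircuit]
      have : o'.2 + o'.1.2 ≤ b - (2 * (j : ℕ) + 1) := by
        split_ifs at ho' with hF
        · rw [QProg.mem_support_run_ret] at ho'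
          simp [ho']
        · exact ih _ _ _ ho'
      dsimp only
      omega

theorem queries_search (F : Q × A → Prop) (b : ℕ) :
    ∀ o ∈ ((search F b).run x).support, o.2 + o.1.2 ≤ b := by
  intro o ho
  rw [search] at ho
  split_ifs at ho with hQ
  · exact queries_searchFrom F _ _ _ _ ho
  · rw [QProg.mem_support_run_ret] at ho
    simp [ho]

theorem queries_dSmallestFrom (f : Q × A → ℕ∞) (g : Q × A → T) (d fuel : ℕ) :
    ∀ (I : Finset (Q × A)) (b : ℕ), ∀ o ∈ ((dSmallestFrom f g d fuel I b).run x).support,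
      o.2 ≤ b := by
  induction fuel with
  | zero =>
    intro I b o ho
    rw [dSmallestFrom, QProg.mem_support_run_ret] at ho
    simp [ho]
  | succ fuel ih =>
    intro I b o ho
    rw [dSmallestFrom] at ho
    obtain ⟨⟨⟨r, b'⟩, c⟩, h1, o₂, h2, rfl⟩ := QProg.mem_support_run_bind ho
    have h3 := queries_search _ _ _ h1
    have h4 : o₂.2 ≤ b' := by
      rcases r with - | r
      · rw [QProg.mem_support_run_ret] at h2
        simp [h2]
      · exact ih _ _ _ h2
    dsimp only at h3 ⊢
    omega

variable {V : Type} [Fintype V]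

theorem queries_boruvkaRound (P : Presentation V Q A) (c : ℝ) (l : ℕ) (F : Finset (Sym2 V)) :
    ∀ o ∈ ((boruvkaRound P c l F).run x).support, o.2 ≤ roundBudget Q c l F := by
  intro o ho
  rw [boruvkaRound] at ho
  obtain ⟨o₁, h1, o₂, h2, rfl⟩ := QProg.mem_support_run_bind ho
  rw [QProg.mem_support_run_ret] at h2
  rw [h2]
  exact queries_dSmallestFrom _ _ _ _ _ _ _ h1

theorem roundBudget_le {c : ℝ} (hc : 0 ≤ c) (l : ℕ) (F : Finset (Sym2 V)) :
    (roundBudget Q c l F : ℝ)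
      ≤ (l + 2) * (√2)⁻¹ ^ (l - 1) * (c * √(Fintype.card V * Fintype.card Q)) := by
  refine (Nat.floor_le (by positivity)).trans ?_
  have h1 : √(min (numTrees F : ℝ) ((Fintype.card V : ℝ) / 2 ^ (l - 1)) * (Fintype.card Q : ℝ))
      ≤ √((Fintype.card V * Fintype.card Q) / 2 ^ (l - 1)) := by
    apply Real.sqrt_le_sqrt
    rw [mul_div_right_comm]
    exact mul_le_mul_of_nonneg_right (min_le_right _ _) (Nat.cast_nonneg _)
  have h2 : √((Fintype.card V * Fintype.card Q : ℝ) / 2 ^ (l - 1))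
      = √(Fintype.card V * Fintype.card Q) * (√2)⁻¹ ^ (l - 1) := by
    rw [Real.sqrt_div (by positivity), inv_pow, div_eq_mul_inv]
    congr 2
    rw [Real.sqrt_eq_iff_mul_self_eq (by positivity) (by positivity), ← mul_pow,
      Real.mul_self_sqrt (by norm_num)]
  rw [h2] at h1
  have := mul_le_mul_of_nonneg_left h1 (show 0 ≤ ((l : ℝ) + 2) * c by positivity)
  linarith

/-- With 1/√2 ≤ 3/4, the tail of the series of budgets is dominated by (5l+25)(3/4)^(l-1), because
(l+2) + (3/4)(5(l+1)+25) ≤ 5l+25. -/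
theorem queries_boruvkaFrom (P : Presentation V Q A) {c : ℝ} (hc : 0 ≤ c) (r : ℕ) :
    ∀ (l : ℕ) (F : Finset (Sym2 V)), 1 ≤ l → ∀ o ∈ ((boruvkaFrom P c r l F).run x).support,
      (o.2 : ℝ) ≤ (5 * l + 25) * (3 / 4) ^ (l - 1)
        * (c * √(Fintype.card V * Fintype.card Q)) := by
  have h34 : (√2)⁻¹ ≤ (3 / 4 : ℝ) := by
    rw [inv_le_comm₀ (by positivity) (by norm_num)]
    exact Real.le_sqrt_of_sq_le (by norm_num)
  induction r with
  | zero =>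
    intro l F hl o ho
    rw [boruvkaFrom, QProg.mem_support_run_ret] at ho
    rw [ho]
    simp only [Nat.cast_zero]
    positivity
  | succ r ih =>
    intro l F hl o ho
    rw [boruvkaFrom] at ho
    split_ifs at ho with h1
    · rw [QProg.mem_support_run_ret] at ho
      rw [ho]
      simp only [Nat.cast_zero]
      positivity
    · obtain ⟨o₁, h1, o₂, h2, rfl⟩ := QProg.mem_support_run_bind ho
      have h3 : (o₁.2 : ℝ) ≤ _ :=
        (Nat.cast_le.2 (queries_boruvkaRound P c l F _ h1)).trans (roundBudget_le hc l F)
      have h4 := ih (l + 1) o₁.1 (by omega) o₂ h2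
      have h5 : (√2)⁻¹ ^ (l - 1) ≤ (3 / 4 : ℝ) ^ (l - 1) := pow_le_pow_left₀ (by positivity) h34 _
      set B := c * √(Fintype.card V * Fintype.card Q : ℝ)
      have hB : 0 ≤ B := by positivity
      have h6 : ((l : ℝ) + 2) * (√2)⁻¹ ^ (l - 1) * B ≤ (l + 2) * (3 / 4) ^ (l - 1) * B := by
        gcongr
      obtain ⟨k, rfl⟩ : ∃ k, l = k + 1 := ⟨l - 1, by omega⟩
      rw [Nat.add_sub_cancel, pow_succ] at h4
      rw [Nat.add_sub_cancel] at h3 h6 ⊢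
      push_cast at h3 h4 h6 ⊢
      have h7 : 0 ≤ (3 / 4 : ℝ) ^ k * B := by positivity
      have h8 : 0 ≤ (k : ℝ) * ((3 / 4 : ℝ) ^ k * B) := by positivity
      nlinarith

end QueryBounds

/-! ### Forests, exchange and the cut property -/

section Forests

variable {V : Type}

theorem edgeGraph_adj {F : Finset (Sym2 V)} {u v : V} :
    (edgeGraph F).Adj u v ↔ s(u, v) ∈ F ∧ u ≠ v := by
  simp [edgeGraph]

theorem edgeGraph_mono {F F' : Finset (Sym2 V)} (h : F ⊆ F') : edgeGraph F ≤ edgeGraph F' :=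
  SimpleGraph.fromEdgeSet_mono (Finset.coe_subset.2 h)

theorem edgeGraph_insert [DecidableEq V] (F : Finset (Sym2 V)) (u v : V) :
    edgeGraph (insert s(u, v) F) = edgeGraph F ⊔ SimpleGraph.edge u v := by
  rw [edgeGraph, edgeGraph, Finset.coe_insert, Set.insert_eq, Set.union_comm,
    SimpleGraph.fromEdgeSet_union, SimpleGraph.edge]

theorem reachable_insert [DecidableEq V] {F : Finset (Sym2 V)} {u v x y : V}
    (h : (edgeGraph (insert s(u, v) F)).Reachable x y) :
    (edgeGraph F).Reachable x y ∨
      ((edgeGraph F).Reachable x u ∧ (edgeGraph F).Reachable v y) ∨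
      ((edgeGraph F).Reachable x v ∧ (edgeGraph F).Reachable u y) := by
  obtain ⟨p⟩ := h
  induction p with
  | nil => exact Or.inl (SimpleGraph.Reachable.refl _)
  | @cons a b c hab p ih =>
    obtain ⟨h1, h2⟩ := edgeGraph_adj.1 hab
    rcases Finset.mem_insert.1 h1 with h1 | h1
    · rcases Sym2.eq_iff.1 h1 with ⟨rfl, rfl⟩ | ⟨rfl, rfl⟩
      · rcases ih with ih | ⟨-, ih⟩ | ⟨-, ih⟩
        · exact Or.inr (Or.inl ⟨.refl _, ih⟩)
        · exact Or.inr (Or.inl ⟨.refl _, ih⟩)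
        · exact Or.inl ih
      · rcases ih with ih | ⟨-, ih⟩ | ⟨-, ih⟩
        · exact Or.inr (Or.inr ⟨.refl _, ih⟩)
        · exact Or.inl ih
        · exact Or.inr (Or.inr ⟨.refl _, ih⟩)
    · have h : (edgeGraph F).Reachable a b := (edgeGraph_adj.2 ⟨h1, h2⟩).reachable
      rcases ih with ih | ⟨h3, ih⟩ | ⟨h3, ih⟩
      · exact Or.inl (h.trans ih)
      · exact Or.inr (Or.inl ⟨h.trans h3, ih⟩)
      · exact Or.inr (Or.inr ⟨h.trans h3, ih⟩)

theorem reachable_insert_self [DecidableEq V] (F : Finset (Sym2 V)) (u v : V) :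
    (edgeGraph (insert s(u, v) F)).Reachable u v := by
  by_cases h : u = v
  · rw [h]
  · exact (edgeGraph_adj.2 ⟨Finset.mem_insert_self _ _, h⟩).reachable

variable {G : SimpleGraph V} {w : Sym2 V → ℕ}

theorem IsForestOf.insert [DecidableEq V] {F : Finset (Sym2 V)} (hF : IsForestOf G F) {u v : V}
    (huv : G.Adj u v) (h : ¬ (edgeGraph F).Reachable u v) :
    IsForestOf G (insert s(u, v) F) := by
  refine ⟨?_, ?_⟩
  · rw [Finset.coe_insert]
    exact Set.insert_subset huv hF.1
  · rw [edgeGraph_insert]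
    exact hF.2.sup_edge_of_not_reachable h

theorem IsForestOf.subset {F F' : Finset (Sym2 V)} (hF : IsForestOf G F) (h : F' ⊆ F) :
    IsForestOf G F' :=
  ⟨(Finset.coe_subset.2 h).trans hF.1, hF.2.anti (edgeGraph_mono h)⟩

theorem notMem_of_not_reachable {F : Finset (Sym2 V)} {u v : V}
    (h : ¬ (edgeGraph F).Reachable u v) : s(u, v) ∉ F := by
  intro h1
  by_cases huv : u = v
  · exact h (huv ▸ .refl _)
  · exact h (edgeGraph_adj.2 ⟨h1, huv⟩).reachable

/-- Otherwise the edge could be added, against maximal cardinality. Connectedness of `G` is not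
needed. -/
theorem IsSpanningForest.reachable {F : Finset (Sym2 V)} (hF : IsSpanningForest G F) {u v : V}
    (huv : G.Adj u v) : (edgeGraph F).Reachable u v := by
  classical
  by_contra h
  have := hF.2 _ (hF.1.insert huv h)
  rw [Finset.card_insert_of_notMem (notMem_of_not_reachable h)] at this
  omega

theorem exists_isMinSpanningForest [Fintype V] (G : SimpleGraph V) (w : Sym2 V → ℕ) :
    ∃ M, IsMinSpanningForest G w M := by
  classical
  have h0 : IsForestOf G ∅ := ⟨by simp, by simp [edgeGraph]⟩
  obtain ⟨F, hF, hmax⟩ := Finset.exists_max_image (Finset.univ.filter (IsForestOf G)) Finset.card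
    ⟨∅, by simpa using h0⟩
  have hFs : IsSpanningForest G F :=
    ⟨(Finset.mem_filter.1 hF).2, fun F' hF' => hmax F' (by simpa using hF')⟩
  obtain ⟨M, hM, hmin⟩ := Finset.exists_min_image (Finset.univ.filter (IsSpanningForest G))
    (fun F => ∑ e ∈ F, w e) ⟨F, by simpa using hFs⟩
  exact ⟨M, (Finset.mem_filter.1 hM).2, fun F' hF' => hmin F' (by simpa using hF')⟩

/-- Deleting an edge of a path in a forest separates the endpoints of the path. -/
theorem not_reachable_erase_of_mem_edges [DecidableEq V] {M : Finset (Sym2 V)}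
    (hM : (edgeGraph M).IsAcyclic) {u v : V} (p : (edgeGraph M).Path u v) {e : Sym2 V}
    (he : e ∈ p.1.edges) : ¬ (edgeGraph (M.erase e)).Reachable u v := by
  rintro ⟨q⟩
  have hle := edgeGraph_mono (Finset.erase_subset e M)
  have h1 : (q.toPath.1.mapLe hle).IsPath := q.toPath.2.mapLe hle
  have h2 := (hM.subsingleton_path u v).elim p ⟨_, h1⟩
  rw [h2] at he
  simp only [SimpleGraph.Walk.edges_mapLe_eq_edges] at he
  have h3 := q.toPath.1.edges_subset_edgeSet he
  rw [edgeGraph, SimpleGraph.edgeSet_fromEdgeSet] at h3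
  simp at h3

/-- The cut property: a lightest edge that leaves a tree of a partial minimum spanning forest can
be added. -/
theorem IsMinSpanningForest.exists_insert_subset [DecidableEq V] {F M : Finset (Sym2 V)}
    (hM : IsMinSpanningForest G w M) (hF : F ⊆ M) {u v : V} (huv : G.Adj u v)
    (hn : ¬ (edgeGraph F).Reachable u v)
    (hmin : ∀ a b, (edgeGraph F).Reachable u a → ¬ (edgeGraph F).Reachable a b → G.Adj a b →
      w s(u, v) ≤ w s(a, b)) :
    ∃ M', IsMinSpanningForest G w M' ∧ insert s(u, v) F ⊆ M' := by
  by_cases he : s(u, v) ∈ M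
  · exact ⟨M, hM, Finset.insert_subset he hF⟩
  obtain ⟨p⟩ := hM.1.reachable huv
  -- The path from `u` to `v` in `M` must leave the tree of `F` around `u`; the edge where it does
  -- so is exchanged for `uv`.
  obtain ⟨d, hd, hd1, hd2⟩ := p.toPath.1.exists_boundary_dart
    {a | (edgeGraph F).Reachable u a} (.refl _) hn
  have hdab : ¬ (edgeGraph F).Reachable d.fst d.snd := fun h => hd2 (hd1.trans h)
  have hdM : s(d.fst, d.snd) ∈ M := (edgeGraph_adj.1 d.adj).1
  have hdF : s(d.fst, d.snd) ∉ F := notMem_of_not_reachable hdab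
  have hsep : ¬ (edgeGraph (M.erase s(d.fst, d.snd))).Reachable u v :=
    not_reachable_erase_of_mem_edges hM.1.1.2 p.toPath (List.mem_map.2 ⟨d, hd, rfl⟩)
  have hforest : IsForestOf G (insert s(u, v) (M.erase s(d.fst, d.snd))) :=
    (hM.1.1.subset (Finset.erase_subset _ _)).insert huv hsep
  have he' : s(u, v) ∉ M.erase s(d.fst, d.snd) := fun h => he (Finset.mem_of_mem_erase h)
  have hcard : (insert s(u, v) (M.erase s(d.fst, d.snd))).card = M.card := by
    rw [Finset.card_insert_of_notMem he', Finset.card_erase_add_one hdM]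
  refine ⟨_, ⟨⟨hforest, fun F' hF' => hcard ▸ hM.1.2 F' hF'⟩, fun F' hF' =>
    le_trans ?_ (hM.2 F' hF')⟩, Finset.insert_subset_insert _ fun e h =>
      Finset.mem_erase.2 ⟨fun h' => hdF (h' ▸ h), hF h⟩⟩
  rw [Finset.sum_insert he', ← Finset.add_sum_erase _ _ hdM]
  exact Nat.add_le_add_right (hmin _ _ hd1 hdab (hM.1.1.1 hdM)) _

/-- An edge of `M` outside `F` could be deleted without separating its endpoints, which is
impossible in a forest. -/
theorem IsMinSpanningForest.of_subset {F M : Finset (Sym2 V)} (hM : IsMinSpanningForest G w M)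
    (hF : F ⊆ M) (h : ∀ u v, G.Adj u v → (edgeGraph F).Reachable u v) :
    IsMinSpanningForest G w F := by
  classical
  suffices F = M by rwa [this]
  refine Finset.Subset.antisymm hF fun e he => ?_
  by_contra hn
  induction e with
  | h u v =>
    have huv : G.Adj u v := hM.1.1.1 he
    have hle : F ⊆ M.erase s(u, v) := fun e' he' =>
      Finset.mem_erase.2 ⟨fun h' => hn (h' ▸ he'), hF he'⟩
    have hadj : (edgeGraph M).Adj u v := edgeGraph_adj.2 ⟨he, huv.ne⟩
    exact not_reachable_erase_of_mem_edges hM.1.1.2 (SimpleGraph.Path.singleton hadj)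
      (SimpleGraph.Path.mk'_mem_edges_singleton hadj) ((h u v huv).mono (edgeGraph_mono hle))

end Forests

/-! ### One round of Borůvka's algorithm -/

section Round

variable {V Q A : Type} [Fintype V] [Fintype Q] [Fintype A] [AddCommGroup A]
  {P : Presentation V Q A} {G : SimpleGraph V} {w : Sym2 V → ℕ}

open Classical in
/-- The black box `x` presents the graph `G` with the weights `w`. -/
structure Presents (P : Presentation V Q A) (x : Q → A) (G : SimpleGraph V) (w : Sym2 V → ℕ) :
    Prop where
  wt_eq : ∀ q, P.wt q (x q)
    = if G.Adj (P.src q) (P.tgt q (x q)) then (w s(P.src q, P.tgt q (x q)) : ℕ∞) else ⊤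
  exists_query : ∀ u v, G.Adj u v → ∃ q, P.src q = u ∧ P.tgt q (x q) = v

/-- The undirected edge that belongs to an item. -/
abbrev itemEdge (P : Presentation V Q A) (o : Q × A) : Sym2 V := s(P.src o.1, P.tgt o.1 o.2)

/-- A choice of a lightest leaving edge for every tree of `F` that has one. -/
structure IsLightestLeaving (P : Presentation V Q A) (G : SimpleGraph V) (w : Sym2 V → ℕ)
    (F : Finset (Sym2 V)) (I : Finset (Q × A)) : Prop where
  adj : ∀ i ∈ I, G.Adj (P.src i.1) (P.tgt i.1 i.2)
  leaves : ∀ i ∈ I, ¬ (edgeGraph F).Reachable (P.src i.1) (P.tgt i.1 i.2)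
  le : ∀ i ∈ I, ∀ a b, (edgeGraph F).Reachable (P.src i.1) a → G.Adj a b →
    ¬ (edgeGraph F).Reachable a b → w (itemEdge P i) ≤ w s(a, b)
  cover : ∀ a b, G.Adj a b → ¬ (edgeGraph F).Reachable a b →
    ∃ i ∈ I, (edgeGraph F).Reachable (P.src i.1) a
  inj : ∀ i ∈ I, ∀ i' ∈ I, (edgeGraph F).Reachable (P.src i.1) (P.src i'.1) → i = i'

theorem leavingWeight_of_lt_top {x : Q → A} (hP : Presents P x G w) {F : Finset (Sym2 V)} {q : Q}
    (h : leavingWeight P F (q, x q) < ⊤) :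
    G.Adj (P.src q) (P.tgt q (x q)) ∧ ¬ (edgeGraph F).Reachable (P.src q) (P.tgt q (x q)) ∧
      leavingWeight P F (q, x q) = w (itemEdge P (q, x q)) := by
  unfold leavingWeight at h ⊢
  split_ifs at h ⊢ with h1
  · simp at h
  · rw [hP.wt_eq] at h ⊢
    split_ifs at h ⊢ with h2
    · exact ⟨h2, h1, rfl⟩
    · simp at h

theorem leavingWeight_of_adj {x : Q → A} (hP : Presents P x G w) {F : Finset (Sym2 V)} {q : Q}
    (h1 : G.Adj (P.src q) (P.tgt q (x q)))
    (h2 : ¬ (edgeGraph F).Reachable (P.src q) (P.tgt q (x q))) :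
      leavingWeight P F (q, x q) = w (itemEdge P (q, x q)) := by
  unfold leavingWeight
  rw [if_neg h2, hP.wt_eq, if_pos h1]

/-- Types are trees and items of finite value are leaving edges. Each edge is presented in both
directions, so every tree sees all edges that leave it. -/
theorem IsOptimal.isLightestLeaving {x : Q → A} (hP : Presents P x G w) {F : Finset (Sym2 V)}
    {I : Finset (Q × A)} (hI : IsOptimal x (leavingWeight P F) (sourceTree P F) I) :
    IsLightestLeaving P G w F I := by
  have hfin : ∀ i ∈ I, G.Adj (P.src i.1) (P.tgt i.1 i.2) ∧
      ¬ (edgeGraph F).Reachable (P.src i.1) (P.tgt i.1 i.2) ∧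
      leavingWeight P F i = w (itemEdge P i) := by
    rintro ⟨q, a⟩ hi
    obtain rfl : a = x q := hI.1.genuine _ hi
    exact leavingWeight_of_lt_top hP (hI.1.finite _ hi)
  have hcover : ∀ a b, G.Adj a b → ¬ (edgeGraph F).Reachable a b →
      ∃ i ∈ I, (edgeGraph F).Reachable (P.src i.1) a ∧ w (itemEdge P i) ≤ w s(a, b) := by
    intro a b hab hn
    obtain ⟨q, rfl, rfl⟩ := hP.exists_query a b hab
    have hw := leavingWeight_of_adj hP hab hn
    obtain ⟨i, hi, h1, h2⟩ := hI.2 q (by rw [hw]; exact ENat.natCast_lt_top _)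
    refine ⟨i, hi, SimpleGraph.ConnectedComponent.exact h1, ?_⟩
    rw [hw, (hfin i hi).2.2] at h2
    exact_mod_cast h2
  have hinj : ∀ i ∈ I, ∀ i' ∈ I, (edgeGraph F).Reachable (P.src i.1) (P.src i'.1) → i = i' :=
    fun i hi i' hi' h => hI.1.inj i hi i' hi' (SimpleGraph.ConnectedComponent.sound h)
  refine ⟨fun i hi => (hfin i hi).1, fun i hi => (hfin i hi).2.1, fun i hi a b h1 h2 h3 => ?_,
    fun a b h1 h2 => ?_, hinj⟩
  · obtain ⟨i', hi', h4, h5⟩ := hcover a b h2 h3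
    rwa [hinj i hi i' hi' (h1.trans h4.symm)]
  · obtain ⟨i, hi, h, -⟩ := hcover a b h1 h2
    exact ⟨i, hi, h⟩

/-- The state while the selected edges are added to `F` one after the other: in a tree of `F'` there
is at most one tree of `F` whose selected edge is missing, and that edge is not heavier than any
edge that leaves one of the trees of `F` in this tree of `F'`. -/
structure IsPartialRound (P : Presentation V Q A) (G : SimpleGraph V) (w : Sym2 V → ℕ)
    (F : Finset (Sym2 V)) (I : Finset (Q × A)) (F' : Finset (Sym2 V)) : Prop where
  subset : F ⊆ F'
  exists_min : ∃ M, IsMinSpanningForest G w M ∧ F' ⊆ M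
  le : ∀ i ∈ I, itemEdge P i ∉ F' → ∀ a b, (edgeGraph F').Reachable (P.src i.1) a → G.Adj a b →
    ¬ (edgeGraph F).Reachable a b → w (itemEdge P i) ≤ w s(a, b)
  inj : ∀ i ∈ I, ∀ i' ∈ I, itemEdge P i ∉ F' → itemEdge P i' ∉ F' →
    (edgeGraph F').Reachable (P.src i.1) (P.src i'.1) → i = i'

/-- With equal weights the selected edges may close cycles, so the cut property is applied afresh at
each insertion. Joining the tree of the source of `i` to that of its target settles the one missing
edge on the source side; at most the missing edge of the target side survives. -/
theorem IsPartialRound.addEdge {F F' : Finset (Sym2 V)} {I : Finset (Q × A)}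
    (hI : IsLightestLeaving P G w F I) (h : IsPartialRound P G w F I F') {i : Q × A}
    (hi : i ∈ I) : IsPartialRound P G w F I (addEdge P F' i) := by
  classical
  rw [_root_.addEdge]
  split_ifs with hr
  · exact h
  have hmem := notMem_of_not_reachable hr
  have hmono := edgeGraph_mono h.subset
  have hadj := hI.adj i hi
  obtain ⟨M, hM, hFM⟩ := h.exists_min
  have hex := hM.exists_insert_subset hFM hadj hr fun a b h1 h2 h3 =>
    h.le i hi hmem a b h1 h3 fun h4 => h2 (h4.mono hmono)
  have hne : ∀ j, itemEdge P j ∉ insert s(P.src i.1, P.tgt i.1 i.2) F' → j ≠ i := by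
    rintro j hj rfl
    exact hj (Finset.mem_insert_self _ _)
  have hold : ∀ j, itemEdge P j ∉ insert s(P.src i.1, P.tgt i.1 i.2) F' → itemEdge P j ∉ F' :=
    fun j hj h => hj (Finset.mem_insert_of_mem h)
  refine ⟨fun e he => Finset.mem_insert_of_mem (h.subset he), ?_, ?_, ?_⟩
  · convert hex
  · intro j hj hjF a b hab h1 h2
    have hjF' : itemEdge P j ∉ insert s(P.src i.1, P.tgt i.1 i.2) F' := by convert hjF
    have hab' : (edgeGraph (insert s(P.src i.1, P.tgt i.1 i.2) F')).Reachable (P.src j.1) a := by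
      convert hab
    rcases reachable_insert hab' with h3 | ⟨h3, h4⟩ | ⟨h3, h4⟩
    · exact h.le j hj (hold j hjF') a b h3 h1 h2
    · exact absurd (h.inj j hj i hi (hold j hjF') hmem h3) (hne j hjF')
    -- The surviving `j` lies on the target side and `a` on the source side. The reversed edge of
    -- `i` leaves the old tree of its target, so `j` is no heavier than `i`, and `i` no heavier than
    -- `ab`.
    · have h5 := h.le j hj (hold j hjF') _ _ h3 hadj.symm fun h => hI.leaves i hi h.symm
      rw [Sym2.eq_swap] at h5
      exact h5.trans (h.le i hi hmem a b h4 h1 h2)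
  · intro j hj j' hj' hjF hjF2 hab
    have hjF' : itemEdge P j ∉ insert s(P.src i.1, P.tgt i.1 i.2) F' := by convert hjF
    have hjF2' : itemEdge P j' ∉ insert s(P.src i.1, P.tgt i.1 i.2) F' := by convert hjF2
    have hab' : (edgeGraph (insert s(P.src i.1, P.tgt i.1 i.2) F')).Reachable
      (P.src j.1) (P.src j'.1) := by convert hab
    rcases reachable_insert hab' with h3 | ⟨h3, -⟩ | ⟨-, h4⟩
    · exact h.inj j hj j' hj' (hold j hjF') (hold j' hjF2') h3
    · exact absurd (h.inj j hj i hi (hold j hjF') hmem h3) (hne j hjF')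
    · exact absurd (h.inj i hi j' hj' hmem (hold j' hjF2') h4).symm (hne j' hjF2')

theorem subset_addEdge (P : Presentation V Q A) (F : Finset (Sym2 V)) (i : Q × A) :
    F ⊆ addEdge P F i := by
  classical
  rw [addEdge]
  split_ifs
  · exact subset_rfl
  · exact fun e he => Finset.mem_insert_of_mem he

theorem subset_foldl_addEdge (P : Presentation V Q A) (L : List (Q × A)) :
    ∀ F : Finset (Sym2 V), F ⊆ L.foldl (addEdge P) F := by
  induction L with
  | nil => exact fun F => subset_rfl
  | cons i L ih => exact fun F => (subset_addEdge P F i).trans (ih _)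

theorem reachable_foldl_addEdge (P : Presentation V Q A) (L : List (Q × A)) :
    ∀ F : Finset (Sym2 V), ∀ i ∈ L,
      (edgeGraph (L.foldl (addEdge P) F)).Reachable (P.src i.1) (P.tgt i.1 i.2) := by
  classical
  induction L with
  | nil => simp
  | cons i L ih =>
    intro F j hj
    rcases List.mem_cons.1 hj with rfl | hj
    · refine SimpleGraph.Reachable.mono (edgeGraph_mono (subset_foldl_addEdge P L _)) ?_
      rw [addEdge]
      split_ifs with h
      · exact h
      · convert reachable_insert_self F _ _
    · exact ih _ j hj

theorem IsPartialRound.foldl {F : Finset (Sym2 V)} {I : Finset (Q × A)}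
    (hI : IsLightestLeaving P G w F I) (L : List (Q × A)) (hL : ∀ i ∈ L, i ∈ I) :
    ∀ F', IsPartialRound P G w F I F' → IsPartialRound P G w F I (L.foldl (_root_.addEdge P) F') := by
  induction L with
  | nil => exact fun F' h => h
  | cons i L ih =>
    exact fun F' h => ih (fun j hj => hL j (List.mem_cons_of_mem _ hj)) _
      (h.addEdge hI (hL i List.mem_cons_self))

/-- The invariant of Borůvka's algorithm before iteration `l`. -/
structure BoruvkaInvariant (G : SimpleGraph V) (w : Sym2 V → ℕ) (l : ℕ) (F : Finset (Sym2 V)) :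
    Prop where
  exists_min : ∃ M, IsMinSpanningForest G w M ∧ F ⊆ M
  le_ncard : ∀ u v, G.Adj u v → ¬ (edgeGraph F).Reachable u v →
    2 ^ (l - 1) ≤ {y | (edgeGraph F).Reachable u y}.ncard

theorem boruvkaInvariant_empty (G : SimpleGraph V) (w : Sym2 V → ℕ) :
    BoruvkaInvariant G w 1 ∅ := by
  obtain ⟨M, hM⟩ := exists_isMinSpanningForest G w
  refine ⟨⟨M, hM, Finset.empty_subset _⟩, fun u v _ _ => ?_⟩
  rw [Nat.sub_self, pow_zero, Nat.one_le_iff_ne_zero]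
  exact Set.ncard_ne_zero_of_mem (a := u) (SimpleGraph.Reachable.refl _)

/-- A new tree that still has a leaving edge contains an old tree with a selected edge, hence both
old trees at its ends. Each has a leaving edge, namely that one, so the sizes add up to twice the
old bound. -/
theorem BoruvkaInvariant.foldl_addEdge {l : ℕ} (hl : 1 ≤ l) {F : Finset (Sym2 V)}
    (h : BoruvkaInvariant G w l F) {I : Finset (Q × A)} (hI : IsLightestLeaving P G w F I) :
    BoruvkaInvariant G w (l + 1) (I.toList.foldl (addEdge P) F) := by
  have h0 : IsPartialRound P G w F I F :=
    ⟨subset_rfl, h.exists_min, fun i hi _ => hI.le i hi, fun i hi i' hi' _ _ => hI.inj i hi i' hi'⟩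
  have h1 := h0.foldl hI I.toList fun i hi => Finset.mem_toList.1 hi
  set F' := I.toList.foldl (addEdge P) F with hF'
  have hmono := edgeGraph_mono h1.subset
  refine ⟨h1.exists_min, fun a b hab hn => ?_⟩
  obtain ⟨i, hi, hia⟩ := hI.cover a b hab fun h => hn (h.mono hmono)
  have hst : (edgeGraph F').Reachable (P.src i.1) (P.tgt i.1 i.2) :=
    reachable_foldl_addEdge P _ F i (Finset.mem_toList.2 hi)
  have hn' := hI.leaves i hi
  have c1 := h.le_ncard _ _ (hI.adj i hi) hn'
  have c2 := h.le_ncard _ _ (hI.adj i hi).symm fun h => hn' h.symm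
  have hdisj : Disjoint {y | (edgeGraph F).Reachable (P.src i.1) y}
      {y | (edgeGraph F).Reachable (P.tgt i.1 i.2) y} :=
    Set.disjoint_left.2 fun y h1 h2 => hn' (SimpleGraph.Reachable.trans h1 h2.symm)
  have hsub : {y | (edgeGraph F).Reachable (P.src i.1) y}
      ∪ {y | (edgeGraph F).Reachable (P.tgt i.1 i.2) y} ⊆ {y | (edgeGraph F').Reachable a y} := by
    rintro y (hy | hy)
    · exact (hia.symm.trans hy).mono hmono
    · exact ((hia.mono hmono).symm.trans hst).trans (SimpleGraph.Reachable.mono hmono hy)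
  have c3 := Set.ncard_le_ncard hsub (Set.toFinite _)
  rw [Set.ncard_union_eq hdisj (Set.toFinite _) (Set.toFinite _)] at c3
  obtain ⟨k, rfl⟩ : ∃ k, l = k + 1 := ⟨l - 1, by omega⟩
  simp only [Nat.add_sub_cancel, pow_succ] at c1 c2 ⊢
  omega

theorem BoruvkaInvariant.isMinSpanningForest {l : ℕ} {F : Finset (Sym2 V)}
    (h : BoruvkaInvariant G w l F) (hr : ∀ u v, G.Adj u v → (edgeGraph F).Reachable u v) :
    IsMinSpanningForest G w F := by
  obtain ⟨M, hM, hFM⟩ := h.exists_min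
  exact hM.of_subset hFM hr

/-- A tree with a leaving edge would have 2^(l-1) ≥ n vertices while missing the other endpoint. -/
theorem BoruvkaInvariant.reachable_of_clog_le {l : ℕ} {F : Finset (Sym2 V)}
    (h : BoruvkaInvariant G w l F) (hl : Nat.clog 2 (Fintype.card V) ≤ l - 1) {u v : V}
    (huv : G.Adj u v) : (edgeGraph F).Reachable u v := by
  by_contra hn
  have h1 := h.le_ncard u v huv hn
  have h2 : Fintype.card V ≤ 2 ^ (l - 1) :=
    (Nat.le_pow_clog one_lt_two _).trans (Nat.pow_le_pow_right two_pos hl)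
  have h3 : {y | (edgeGraph F).Reachable u y}.ncard < (Set.univ : Set V).ncard :=
    Set.ncard_lt_ncard ((Set.ssubset_univ_iff).2 fun h => hn (h ▸ Set.mem_univ v : v ∈ _))
  rw [Set.ncard_univ, Nat.card_eq_fintype_card] at h3
  omega

theorem reachable_of_numTrees_eq_one {F : Finset (Sym2 V)} (h : numTrees F = 1) (u v : V) :
    (edgeGraph F).Reachable u v := by
  have := (Nat.card_eq_one_iff_unique.1 h).1
  exact SimpleGraph.ConnectedComponent.exact (Subsingleton.elim _ _)

/-- The number of trees that have a leaving edge. -/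
theorem BoruvkaInvariant.ncard_le {l : ℕ} {F : Finset (Sym2 V)} {x : Q → A}
    (h : BoruvkaInvariant G w l F) (hP : Presents P x G w) :
    (((Set.range fun q : Q => (q, x q)) ∩ {o | leavingWeight P F o < ⊤}).image
      (sourceTree P F)).ncard ≤ min (numTrees F : ℝ) (Fintype.card V / 2 ^ (l - 1)) := by
  classical
  set S := ((Set.range fun q : Q => (q, x q)) ∩ {o | leavingWeight P F o < ⊤}).image
      (sourceTree P F) with hS
  refine le_min ?_ ?_
  · rw [numTrees, ← Set.ncard_univ]
    exact Nat.cast_le.2 (Set.ncard_le_ncard (Set.subset_univ _) (Set.toFinite _))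
  · rw [le_div_iff₀ (by positivity)]
    have hfin : S.Finite := Set.toFinite _
    have hmaps : ∀ v ∈ Finset.univ.filter fun v : V =>
        (edgeGraph F).connectedComponentMk v ∈ hfin.toFinset,
        (edgeGraph F).connectedComponentMk v ∈ hfin.toFinset :=
      fun v hv => (Finset.mem_filter.1 hv).2
    -- Count vertices: the trees are disjoint, and each tree with a leaving edge holds at least
    -- 2^(l-1) of them.
    have h1 := Finset.card_eq_sum_card_fiberwise hmaps
    have h2 : ∀ c ∈ hfin.toFinset, 2 ^ (l - 1) ≤ ((Finset.univ.filter fun v : V =>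
        (edgeGraph F).connectedComponentMk v ∈ hfin.toFinset).filter fun v =>
          (edgeGraph F).connectedComponentMk v = c).card := by
      intro c hc
      obtain ⟨-, ⟨⟨q, rfl⟩, hq⟩, rfl⟩ := hfin.mem_toFinset.1 hc
      obtain ⟨ha, hn, -⟩ := leavingWeight_of_lt_top hP hq
      refine (h.le_ncard _ _ ha hn).trans ?_
      rw [← Set.ncard_coe_finset]
      refine Set.ncard_le_ncard (fun y hy => ?_) (Set.toFinite _)
      have : (edgeGraph F).connectedComponentMk y = sourceTree P F (q, x q) :=
        SimpleGraph.ConnectedComponent.sound (SimpleGraph.Reachable.symm hy)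
      simp only [Finset.coe_filter, Finset.mem_univ, Finset.mem_filter, true_and,
        Set.mem_ofPred_eq, this, and_true]
      exact hc
    have h3 := Finset.card_nsmul_le_sum _ _ _ h2
    rw [← h1, smul_eq_mul, ← Set.ncard_eq_toFinset_card S hfin] at h3
    exact_mod_cast h3.trans (Finset.card_le_univ _)

end Round

/-! ### Failure probability of the whole algorithm -/

section Main

variable {V Q A : Type} [Fintype V] [Fintype Q] [Fintype A] [AddCommGroup A]
  {P : Presentation V Q A} {G : SimpleGraph V} {w : Sym2 V → ℕ} {x : Q → A}

theorem two_mul_exp_le {l : ℕ} {y : ℝ} (h : 2 * l + 3 ≤ y) :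
    2 * Real.exp (-y) ≤ (1 / 2) ^ (l + 2) := by
  have h1 : Real.exp (-y) ≤ Real.exp (-1) ^ (2 * l + 3) := by
    rw [← Real.exp_nat_mul]
    apply Real.exp_le_exp.2
    push_cast
    linarith
  have h2 : Real.exp (-1) ≤ 1 / 2 := by
    rw [Real.exp_neg, inv_le_comm₀ (Real.exp_pos _) (by norm_num)]
    have := Real.add_one_le_exp 1
    norm_num at this ⊢
    exact this
  have h3 := pow_le_pow_left₀ (Real.exp_pos (-1)).le h2 (2 * l + 3)
  have h4 : (1 / 2 : ℝ) ^ (2 * l + 2) ≤ (1 / 2) ^ (l + 2) :=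
    pow_le_pow_of_le_one (by norm_num) (by norm_num) (by omega)
  have h5 : (1 / 2 : ℝ) ^ (2 * l + 3) = (1 / 2) ^ (2 * l + 2) * (1 / 2) := pow_succ _ _
  linarith

/-- A single round misses a lightest edge with probability at most `2 ^ -(l + 2)`. -/
theorem BoruvkaInvariant.expect_dSmallest_le (hP : Presents P x G w) {l : ℕ}
    {F : Finset (Sym2 V)} (h : BoruvkaInvariant G w l F) :
    (dSmallest (leavingWeight P F) (sourceTree P F) (numTrees F) (roundBudget Q 2592 l F)).expect x
      ({I | IsOptimal x (leavingWeight P F) (sourceTree P F) I}ᶜ.indicator 1)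
      ≤ (1 / 2) ^ (l + 2) := by
  classical
  by_cases hq : ∃ q, leavingWeight P F (q, x q) < ⊤
  · obtain ⟨q, hq⟩ := hq
    have hQ : Nonempty Q := ⟨q⟩
    have ht := h.ncard_le hP
    set τ := min (numTrees F : ℝ) (Fintype.card V / 2 ^ (l - 1)) with hτ
    have hτ1 : 1 ≤ τ := by
      refine le_trans ?_ ht
      rw [Nat.one_le_cast, Nat.one_le_iff_ne_zero]
      exact Set.ncard_ne_zero_of_mem (Set.mem_image_of_mem _ ⟨⟨q, rfl⟩, hq⟩)
    refine (_root_.expect_dSmallest_le le_rfl hτ1 hQ ht _).trans (two_mul_exp_le ?_)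
    have hN : (1 : ℝ) ≤ Fintype.card Q := by exact_mod_cast Fintype.card_pos
    set R := √(τ * Fintype.card Q) with hR
    have hR1 : 1 ≤ R := Real.one_le_sqrt.2 (one_le_mul_of_one_le_of_one_le hτ1 hN)
    -- Since 2592 = 2 · 1296, the exponent is 2l+4 up to rounding; the floor costs less than 1, and
    -- 1296R ≥ 1, leaving 2l+3.
    rw [le_div_iff₀ (by positivity)]
    have hb := (Nat.lt_floor_add_one (((l : ℝ) + 2) * 2592 * R)).le
    rw [roundBudget]
    have hl : 0 ≤ (l : ℝ) := Nat.cast_nonneg l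
    nlinarith
  -- Without a leaving edge the tail bound is unavailable (`Q` may be empty, τ below 1), but the
  -- empty selection is already optimal.
  · have hI : IsSelection x (leavingWeight P F) (sourceTree P F) ∅ :=
      ⟨by simp, by simp, by simp⟩
    refine (hI.expect_dSmallestFrom_eq_zero le_rfl ?_ _ _).trans (by positivity)
    refine Finset.eq_empty_of_forall_notMem fun q hq' => hq ⟨q, ?_⟩
    exact ((hI.isGood_iff le_rfl).1 (mem_solutions.1 hq')).1

theorem BoruvkaInvariant.expect_boruvkaRound_le (hP : Presents P x G w) {l : ℕ} (hl : 1 ≤ l)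
    {F : Finset (Sym2 V)} (h : BoruvkaInvariant G w l F) :
    (boruvkaRound P 2592 l F).expect x ({F | BoruvkaInvariant G w (l + 1) F}ᶜ.indicator 1)
      ≤ (1 / 2) ^ (l + 2) := by
  rw [boruvkaRound, QProg.expect_bind]
  refine (QProg.expect_mono (fun I => ?_) _).trans (h.expect_dSmallest_le hP)
  simp only [QProg.expect]
  by_cases hI : IsOptimal x (leavingWeight P F) (sourceTree P F) I
  · rw [Set.indicator_of_notMem]
    · exact Set.indicator_nonneg (fun _ _ => zero_le_one) _
    · exact fun hn => hn (h.foldl_addEdge hl (hI.isLightestLeaving hP))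
  · rw [Set.indicator_of_mem (s := {I | IsOptimal _ _ _ I}ᶜ) (by exact hI)]
    exact Set.indicator_le_self' (fun _ _ => zero_le_one) _

/-- Union bound over the rounds: the failure probabilities 2^-(l'+2) for l' ≥ l sum to 2^-(l+1). -/
theorem BoruvkaInvariant.expect_boruvkaFrom_le (hP : Presents P x G w) (r : ℕ) :
    ∀ (l : ℕ) (F : Finset (Sym2 V)), 1 ≤ l → Nat.clog 2 (Fintype.card V) ≤ r + (l - 1) →
      BoruvkaInvariant G w l F →
      (boruvkaFrom P 2592 r l F).expect x ({F | IsMinSpanningForest G w F}ᶜ.indicator 1)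
        ≤ (1 / 2) ^ (l + 1) := by
  induction r with
  | zero =>
    intro l F hl hr h
    rw [boruvkaFrom, QProg.expect, Set.indicator_of_notMem]
    · positivity
    · exact fun hn => hn (h.isMinSpanningForest fun u v huv =>
        h.reachable_of_clog_le (by omega) huv)
  | succ r ih =>
    intro l F hl hr h
    rw [boruvkaFrom]
    split_ifs with h1
    · rw [QProg.expect, Set.indicator_of_notMem]
      · positivity
      · exact fun hn => hn (h.isMinSpanningForest fun u v _ => reachable_of_numTrees_eq_one h1 u v)
    · rw [QProg.expect_bind]
      refine (QProg.expect_mono (h' := fun F' =>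
        {F | BoruvkaInvariant G w (l + 1) F}ᶜ.indicator 1 F' + (1 / 2) ^ (l + 2))
        (fun F' => ?_) _).trans ?_
      · by_cases hF' : BoruvkaInvariant G w (l + 1) F'
        · rw [Set.indicator_of_notMem (not_not_intro hF'), zero_add]
          exact ih (l + 1) F' (by omega) (by omega) hF'
        · rw [Set.indicator_of_mem (by exact hF')]
          refine (QProg.expect_le_of_le (fun _ =>
            Set.indicator_le_self' (fun _ _ => zero_le_one) _) _).trans ?_
          simp only [Pi.one_apply]
          linarith [show (0 : ℝ) ≤ (1 / 2) ^ (l + 2) by positivity]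
      · rw [QProg.expect_add, QProg.expect_const]
        have := h.expect_boruvkaRound_le hP hl
        have h2 : (1 / 2 : ℝ) ^ (l + 2) = (1 / 2) ^ (l + 1) * (1 / 2) := pow_succ _ _
        linarith

/-- The quantum Borůvka algorithm succeeds with probability at least `3 / 4`. -/
theorem Presents.le_prob_boruvka (hP : Presents P x G w) :
    3 / 4 ≤ (boruvka P 2592).prob x {F | IsMinSpanningForest G w F} := by
  have h := (boruvkaInvariant_empty G w).expect_boruvkaFrom_le hP (Nat.clog 2 (Fintype.card V))
    1 ∅ le_rfl (by omega)
  refine le_trans (le_of_eq ?_) (QProg.le_prob_of_expect_compl_le h)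
  rw [show (1 - (1 / 2) ^ (1 + 1) : ℝ) = 3 / 4 by norm_num,
    ENNReal.ofReal_div_of_pos (by norm_num)]
  norm_num

/-- 77760 = 30 · 2592, where 30 is 5l+25 at l = 1. -/
theorem queriesAtMost_boruvka (P : Presentation V Q A) (x : Q → A) :
    (boruvka P 2592).QueriesAtMost x (77760 * √(Fintype.card V * Fintype.card Q)) := by
  intro o ho
  refine (queries_boruvkaFrom P (by norm_num) _ 1 ∅ le_rfl o ho).trans (le_of_eq ?_)
  norm_num
  ring

end Main

/-! ### The array and matrix models -/

section Models

variable {n W : ℕ} {G : SimpleGraph (Fin n)} {w : Sym2 (Fin n) → ℕ}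

theorem IsArrayInput.presents {deg : Fin n → ℕ}
    {x : (Σ u : Fin n, Fin (deg u)) → Fin n × Fin (W + 1)}
    (h : IsArrayInput G w deg x) : Presents (arrayPresentation n W deg) x G w := by
  refine ⟨fun q => ?_, fun u v huv => ?_⟩
  · have hadj : G.Adj q.1 (x q).1 := (h.adj _ _).2 ⟨q.2, rfl⟩
    exact (congrArg Nat.cast (h.weight q.1 q.2)).trans (if_pos hadj).symm
  · obtain ⟨j, hj⟩ := (h.adj u v).1 huv
    exact ⟨⟨u, j⟩, rfl, hj⟩

/-- Array entries inject into the darts of `G`, because the neighbours in each list are distinct. -/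
theorem IsArrayInput.card_le {deg : Fin n → ℕ}
    {x : (Σ u : Fin n, Fin (deg u)) → Fin n × Fin (W + 1)} (h : IsArrayInput G w deg x) :
    Fintype.card (Σ u : Fin n, Fin (deg u)) ≤ 2 * G.edgeSet.ncard := by
  classical
  rw [← SimpleGraph.coe_edgeFinset, Set.ncard_coe_finset, ← G.dart_card_eq_twice_card_edges]
  refine Fintype.card_le_of_injective
    (fun q => (⟨(q.1, (x q).1), (h.adj _ _).2 ⟨q.2, rfl⟩⟩ : G.Dart)) ?_
  rintro ⟨u, j⟩ ⟨u', j'⟩ hq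
  simp only [SimpleGraph.Dart.mk.injEq, Prod.mk.injEq] at hq
  obtain ⟨rfl, hq⟩ := hq
  rw [h.simple u hq]

theorem IsMatrixInput.presents {x : Fin n × Fin n → Fin (W + 2)}
    (h : IsMatrixInput G w x) : Presents (matrixPresentation n W) x G w :=
  ⟨fun q => h q.1 q.2, fun u v _ => ⟨(u, v), rfl, rfl⟩⟩

end Models

theorem mainTheorem2 :
    ∃ c C : ℝ, 0 < c ∧ 0 < C ∧
      ∀ (n W : ℕ) [NeZero n] (G : SimpleGraph (Fin n)) (w : Sym2 (Fin n) → ℕ),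
        (∀ (deg : Fin n → ℕ) (x : (Σ u : Fin n, Fin (deg u)) → Fin n × Fin (W + 1)),
          IsArrayInput G w deg x →
            3 / 4 ≤ (boruvka (arrayPresentation n W deg) c).prob x
                {F | IsMinSpanningForest G w F} ∧
              (boruvka (arrayPresentation n W deg) c).QueriesAtMost x
                (C * √((n : ℝ) * (G.edgeSet.ncard : ℝ)))) ∧
        (∀ x : Fin n × Fin n → Fin (W + 2),
          IsMatrixInput G w x →
            3 / 4 ≤ (boruvka (matrixPresentation n W) c).prob x
                {F | IsMinSpanningForest G w F} ∧
              (boruvka (matrixPresentation n W) c).QueriesAtMost x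
                (C * (n : ℝ) ^ (3 / 2 : ℝ))) := by
  -- The factor √2 comes from N ≤ 2m in the array model and is slack in the matrix model.
  refine ⟨2592, 77760 * √2, by norm_num, by positivity, fun n W _ G w =>
    ⟨fun deg x h => ⟨h.presents.le_prob_boruvka, fun o ho => ?_⟩,
      fun x h => ⟨h.presents.le_prob_boruvka, fun o ho => ?_⟩⟩⟩
  · refine (queriesAtMost_boruvka _ _ o ho).trans ?_
    rw [mul_assoc, ← Real.sqrt_mul (by norm_num)]
    refine mul_le_mul_of_nonneg_left (Real.sqrt_le_sqrt ?_) (by norm_num)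
    have hc : (Fintype.card (Σ u : Fin n, Fin (deg u)) : ℝ) ≤ 2 * G.edgeSet.ncard := by
      exact_mod_cast h.card_le
    have := mul_le_mul_of_nonneg_left hc (Nat.cast_nonneg (α := ℝ) n)
    rw [Fintype.card_fin]
    linarith
  · refine (queriesAtMost_boruvka _ _ o ho).trans ?_
    have hn : (0 : ℝ) ≤ n := Nat.cast_nonneg n
    have e : √((Fintype.card (Fin n) : ℝ) * (Fintype.card (Fin n × Fin n) : ℝ))
        = (n : ℝ) ^ (3 / 2 : ℝ) := by
      rw [Fintype.card_prod, Fintype.card_fin, Real.sqrt_eq_rpow]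
      push_cast
      rw [show (n : ℝ) * (n * n) = (n : ℝ) ^ (3 : ℝ) by norm_cast; ring, ← Real.rpow_mul hn]
      norm_num
    rw [e]
    refine mul_le_mul_of_nonneg_right ?_ (Real.rpow_nonneg hn _)
    have : (1 : ℝ) ≤ √2 := Real.one_le_sqrt.2 (by norm_num)
    linarith
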